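/- Let $X$ be a finite regular CW complex. For cells write $x\le y$ if the closed cell $x$ is contained in the closed cell $y$, and $x<y$ if moreover $x\ne y$. Let $f$ be a discrete Morse function on $X$: a real-valued function on the cells such that for every $k$-cell $x$ there is at most one $(k+1)$-cell $y\ge x$ with $f(x)\ge f(y)$ and at most one $(k-1)$-cell $y\le x$ with $f(y)\ge f(x)$; the cell $x$ is critical if there are no such cells $y$ of either kind. A pair $\{x,y\}$ with $x \le y$, $\dim y=\dim x+1$ and $f(x)\ge f(y)$ is called a regular pair. Let $\mathrm{Ent}[X]$ be the category whose objects are the cells, whose morphisms $x\to y$ are the strictly descending sequences of cells $(x=x_0>\dots>x_k=y)$, and whose composition is concatenation. Let $\Sigma$ be the set of morphisms $(y>x)$ with $\{x,y\}$ a regular pair and let $\Sigma^+$ be $\Sigma$ together with all identities. The category $\mathrm{Loc}_\Sigma[X]$ has the same objects; its morphisms $w\to z$ are classes of zigzags $w\xrightarrow{g_0}y_0\xleftarrow{f_0}x_0\xrightarrow{g_1}y_1\xleftarrow{f_1}\cdots\xleftarrow{f_k}x_k\xrightarrow{g_{k+1}}z$ in $\mathrm{Ent}[X]$ with all $f_i\in\Sigma^+$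 (a single arrow $w\xrightarrow{g_0}z$ is allowed), modulo the equivalence relation generated by removing intermediate identity maps (composing the adjacent arrows) and by relating the two rows of a commutative ladder whose vertical maps lie in $\Sigma^+$ and whose outer vertical maps are $\mathrm{id}_w$ and $\mathrm{id}_z$; composition is concatenation of zigzags. The discrete flow category of $f$ is the full subcategory of $\mathrm{Loc}_\Sigma[X]$ on the critical cells. A finite sequence of cells represents a morphism $[\gamma]$ if it is obtained, for some zigzag in the class $[\gamma]$, by concatenating the sequences $g_0,g_1,\dots,g_{k+1}$. Let $w,z$ be critical cells and let $\mathrm{Hom}(w,z)$ be the set of morphisms from $w$ to $z$ in the discrete flow category. Then every $[\gamma]\in\mathrm{Hom}(w,z)$ is represented by a unique sequence $(w=x_0,x_1,\dots,x_k=z)$ of cells such that 1. no two elements of the sequence are equal, and 2. for all $i<k$, either $x_{i+1}<x_i$ or $\{x_i,x_{i+1}\}$ is a regular pair. Conversely, every sequence from $w$ to $z$ with properties 1 and 2 represents exactly one morphism in $\mathrm{Hom}(w,z)$. Hence the morphisms in $\mathrm{Hom}(w,z)$ correspond bijectively to the simple directed paths from $w$ to $z$ in the directed graph on the cells with an edge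 $u\to v$ whenever $v<u$ or $\{u,v\}$ is a regular pair. -/

import Mathlib

open CategoryTheory

universe u v

namespace DiscreteFlow

/-! ### Regular CW complexes, their cells and the face relation -/

section Cells

open Topology Metric

variable {X : Type u} [TopologicalSpace X]

/-- A CW complex is regular if every characteristic map is injective on the whole closed ball.
In a Hausdorff space this says that it is a homeomorphism from the closed ball onto the closed
cell. -/
def IsRegularCW (C : Set X) [CWComplex C] : Prop :=
  ∀ (n : ℕ) (i : RelCWComplex.cell C n), Set.InjOn (RelCWComplex.map n i) (closedBall 0 1)

/-- The cells of a CW complex, of all dimensions. -/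
structure Cell (C : Set X) [CWComplex C] where
  /-- The dimension of the cell. -/
  dim : ℕ
  /-- The index of the cell among the cells of its dimension. -/
  idx : RelCWComplex.cell C dim

variable {C : Set X} [CWComplex C]

/-- The closed cell, as a subset of the ambient space. -/
def Cell.carrier (x : Cell C) : Set X := RelCWComplex.closedCell x.dim x.idx

variable [T2Space X]

theorem Cell.eq_of_carrier_eq_of_dim_le {x y : Cell C} (h : x.carrier = y.carrier)
    (hd : x.dim ≤ y.dim) : x = y := by
  obtain ⟨n, i⟩ := x
  obtain ⟨m, j⟩ := y
  by_contra hne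
  have hne' : (⟨n, i⟩ : Σ n, RelCWComplex.cell C n) ≠ ⟨m, j⟩ := by
    intro h'
    cases h'
    exact hne rfl
  obtain ⟨p, hp⟩ : (RelCWComplex.openCell m j).Nonempty := RelCWComplex.openCell_nonempty m j
  have hpx : p ∈ RelCWComplex.closedCell n i := by
    have : p ∈ (Cell.mk m j).carrier := RelCWComplex.openCell_subset_closedCell m j hp
    rw [← h] at this
    exact this
  rw [← RelCWComplex.cellFrontier_union_openCell_eq_closedCell] at hpx
  rcases hpx with hpx | hpx
  · have h1 := RelCWComplex.cellFrontier_subset_skeletonLT n i hpx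
    have h2 : p ∈ RelCWComplex.skeletonLT C (m : ℕ∞) :=
      RelCWComplex.skeletonLT_mono (Nat.cast_le.2 hd) h1
    exact Set.disjoint_left.1 (RelCWComplex.disjoint_skeletonLT_openCell le_rfl) h2 hp
  · exact Set.disjoint_left.1 (RelCWComplex.disjoint_openCell_of_ne hne') hpx hp

/-- The face order: `x ≤ y` if the closed cell `x` is contained in the closed cell `y`. -/
instance : PartialOrder (Cell C) where
  le x y := x.carrier ⊆ y.carrier
  le_refl _ := Set.Subset.rfl
  le_trans _ _ _ := Set.Subset.trans
  le_antisymm x y h₁ h₂ := by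
    have h := Set.Subset.antisymm h₁ h₂
    rcases le_total x.dim y.dim with hd | hd
    · exact Cell.eq_of_carrier_eq_of_dim_le h hd
    · exact (Cell.eq_of_carrier_eq_of_dim_le h.symm hd).symm

/-! ### Discrete Morse functions -/

/-- A discrete Morse function: for every cell `x` there is at most one cell `y` of one dimension
higher with `x ⊆ y` and `f x ≥ f y`, and at most one cell `y` of one dimension lower with `y ⊆ x`
and `f y ≥ f x`. -/
def IsDiscreteMorse (f : Cell C → ℝ) : Prop :=
  ∀ x : Cell C,
    {y : Cell C | y.dim = x.dim + 1 ∧ x ≤ y ∧ f x ≥ f y}.Subsingleton ∧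
    {y : Cell C | y.dim + 1 = x.dim ∧ y ≤ x ∧ f y ≥ f x}.Subsingleton

/-- The cell `x` is critical for `f`. -/
def IsCritical (f : Cell C → ℝ) (x : Cell C) : Prop :=
  (¬ ∃ y : Cell C, y.dim = x.dim + 1 ∧ x ≤ y ∧ f x ≥ f y) ∧
  (¬ ∃ y : Cell C, y.dim + 1 = x.dim ∧ y ≤ x ∧ f y ≥ f x)

/-- `{x, y}` is a regular pair of `f`, with `x` the cell of lower dimension. -/
def IsRegularPair (f : Cell C → ℝ) (x y : Cell C) : Prop :=
  y.dim = x.dim + 1 ∧ x ≤ y ∧ f x ≥ f y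

end Cells

/-! ### The entrance path category -/

/-- Strictly descending sequences `x = x₀ > x₁ > ⋯ > xₖ = y` in a partial order. -/
@[ext]
structure DescSeq {P : Type u} [PartialOrder P] (x y : P) where
  /-- The list `[x₀, x₁, …, xₖ]`. -/
  seq : List P
  isChain : seq.IsChain (· > ·)
  head_eq : seq.head? = some x
  last_eq : seq.getLast? = some y

/-- The one-element sequence `(x)`. -/
def DescSeq.nil {P : Type u} [PartialOrder P] (x : P) : DescSeq x x where
  seq := [x]
  isChain := by simp
  head_eq := rfl
  last_eq := rfl

/-- Concatenation of `(x > ⋯ > y)` and `(y > ⋯ > z)`, with `y` written once. -/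
def DescSeq.append {P : Type u} [PartialOrder P] {x y z : P} (a : DescSeq x y) (b : DescSeq y z) :
    DescSeq x z where
  seq := a.seq ++ b.seq.tail
  isChain := by
    obtain ⟨l, hl, hx, hy⟩ := a
    obtain ⟨l', hl', hy', hz⟩ := b
    cases l' with
    | nil => simp at hy'
    | cons c t =>
      simp only [List.head?_cons, Option.some.injEq] at hy'
      subst hy'
      simp only [List.tail_cons]
      refine List.isChain_append.2 ⟨hl, hl'.tail, ?_⟩
      intro p hp q hq
      rw [hy] at hp
      obtain rfl : c = p := by simpa using hp
      cases t with
      | nil => simp at hq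
      | cons d t =>
        obtain rfl : d = q := by simpa using hq
        exact (List.isChain_cons_cons.1 hl').1
  head_eq := by
    rw [List.head?_append, a.head_eq]
    rfl
  last_eq := by
    obtain ⟨l, hl, hx, hy⟩ := a
    obtain ⟨l', hl', hy', hz⟩ := b
    cases l' with
    | nil => simp at hy'
    | cons c t =>
      simp only [List.head?_cons, Option.some.injEq] at hy'
      subst hy'
      cases t with
      | nil => simpa [hy] using hz
      | cons d t => simpa [List.getLast?_append] using hz

/-- The objects of the entrance path category: the cells of the complex. -/
structure Ent (P : Type u) where
  /-- The underlying cell. -/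
  cell : P

/-- The entrance path category of a poset of cells: a morphism `x ⟶ y` is a strictly descending
sequence of cells from `x` to `y`, and composition is concatenation. -/
instance Ent.category (P : Type u) [PartialOrder P] : Category.{u} (Ent P) where
  Hom x y := DescSeq x.cell y.cell
  id x := DescSeq.nil x.cell
  comp a b := a.append b
  id_comp := by
    rintro ⟨x⟩ ⟨y⟩ ⟨l, hl, hx, hy⟩
    apply DescSeq.ext
    cases l with
    | nil => simp at hx
    | cons c t =>
      simp only [List.head?_cons, Option.some.injEq] at hx
      subst hx
      rfl
  comp_id := by
    rintro ⟨x⟩ ⟨y⟩ a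
    apply DescSeq.ext
    exact List.append_nil _
  assoc := by
    rintro ⟨x⟩ ⟨y⟩ ⟨z⟩ ⟨t⟩ a b c
    apply DescSeq.ext
    obtain ⟨l, hl, hy, hz⟩ := b
    cases l with
    | nil => simp at hy
    | cons d t => simp [DescSeq.append]

/-- The sequence of cells of a morphism of the entrance path category. -/
def Ent.seq {P : Type u} [PartialOrder P] {x y : Ent P} (g : x ⟶ y) : List P :=
  DescSeq.seq g

/-! ### Localization by zigzags -/

section Localization

variable {E : Type u} [Category.{v} E]

/-- The class `Σ⁺`: the morphisms in `S` together with all identities. -/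
inductive Plus (S : MorphismProperty E) : MorphismProperty E
  | of {x y : E} (f : x ⟶ y) (hf : S f) : Plus S f
  | id (x : E) : Plus S (𝟙 x)

/-- Zigzags `w ⟶ y₀ ⟵ x₀ ⟶ y₁ ⟵ ⋯ ⟵ xₖ ⟶ z` whose backward arrows lie in `Σ⁺`. A zigzag may
consist of a single forward arrow. -/
inductive Zigzag (S : MorphismProperty E) : E → E → Type (max u v)
  | single {w z : E} (g : w ⟶ z) : Zigzag S w z
  | cons {w y x z : E} (g : w ⟶ y) (f : x ⟶ y) (hf : Plus S f) (t : Zigzag S x z) : Zigzag S w z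

variable {S : MorphismProperty E}

namespace Zigzag

/-- Composes the first forward arrow of a zigzag with a morphism. -/
def precomp {w w' z : E} (g : w ⟶ w') : Zigzag S w' z → Zigzag S w z
  | single g' => single (g ≫ g')
  | cons g' f hf t => cons (g ≫ g') f hf t

/-- Concatenation of zigzags; the two forward arrows that meet are composed. -/
def append {w w' z : E} : Zigzag S w w' → Zigzag S w' z → Zigzag S w z
  | single g, s => precomp g s
  | cons g f hf t, s => cons g f hf (append t s)

/-- `Horizontal s t` says that `t` arises from `s` by removing one intermediate identity map,
backward or forward, and composing the two arrows adjacent to it. -/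
inductive Horizontal : {w z : E} → Zigzag S w z → Zigzag S w z → Prop
  | backward {w y z : E} (g : w ⟶ y) (t : Zigzag S y z) :
      Horizontal (cons g (𝟙 y) (Plus.id y) t) (precomp g t)
  | forward {w y x x' z : E} (g : w ⟶ y) (f : x ⟶ y) (hf : Plus S f) (f' : x' ⟶ x)
      (hf' : Plus S f') (h : Plus S (f' ≫ f)) (t : Zigzag S x' z) :
      Horizontal (cons g f hf (cons (𝟙 x) f' hf' t)) (cons g (f' ≫ f) h t)
  | cons {w y x z : E} (g : w ⟶ y) (f : x ⟶ y) (hf : Plus S f) {s t : Zigzag S x z}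
      (h : Horizontal s t) : Horizontal (cons g f hf s) (cons g f hf t)

/-- `Ladder v s t` says that `s` and `t` are the rows of a commutative ladder whose vertical maps
lie in `Σ⁺`, the leftmost one being `v` and the rightmost one an identity. -/
inductive Ladder : {w w' z : E} → (w ⟶ w') → Zigzag S w z → Zigzag S w' z → Prop
  | single {w w' z : E} (v : w ⟶ w') (g : w ⟶ z) (g' : w' ⟶ z) (hg : g = v ≫ g') :
      Ladder v (single g) (single g')
  | cons {w w' y y' x x' z : E} (v : w ⟶ w') (g : w ⟶ y) (g' : w' ⟶ y')
      (f : x ⟶ y) (f' : x' ⟶ y') (hf : Plus S f) (hf' : Plus S f')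
      (u : y ⟶ y') (hu : Plus S u) (v' : x ⟶ x') (hv' : Plus S v')
      (hg : g ≫ u = v ≫ g') (hfu : f ≫ u = v' ≫ f')
      {t : Zigzag S x z} {t' : Zigzag S x' z} (h : Ladder v' t t') :
      Ladder v (cons g f hf t) (cons g' f' hf' t')

/-- Vertical relation: the rows of a commutative ladder with identities at both ends. -/
def Vertical {w z : E} (s t : Zigzag S w z) : Prop := Ladder (𝟙 w) s t

/-- Elementary relation between zigzags: horizontal or vertical. -/
def Rel {w z : E} (s t : Zigzag S w z) : Prop := Horizontal s t ∨ Vertical s t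

theorem precomp_id {w z : E} (t : Zigzag S w z) : precomp (𝟙 w) t = t := by
  cases t <;> simp [precomp]

theorem precomp_precomp {w w' w'' z : E} (g : w ⟶ w') (g' : w' ⟶ w'') (t : Zigzag S w'' z) :
    precomp g (precomp g' t) = precomp (g ≫ g') t := by
  cases t <;> simp [precomp]

theorem precomp_append {w w' w'' z : E} (g : w ⟶ w') (s : Zigzag S w' w'') (t : Zigzag S w'' z) :
    append (precomp g s) t = precomp g (append s t) := by
  cases s with
  | single g' => exact (precomp_precomp g g' t).symm
  | cons g' f hf s => rfl

theorem append_id {w z : E} (t : Zigzag S w z) : append t (single (𝟙 z)) = t := by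
  induction t with
  | single g => simp [append, precomp]
  | cons g f hf t ih => simp [append, ih]

theorem append_assoc {a b c d : E} (r : Zigzag S a b) (s : Zigzag S b c) (t : Zigzag S c d) :
    append (append r s) t = append r (append s t) := by
  induction r with
  | single g => simp [append, precomp_append]
  | cons g f hf r ih => simp [append, ih]

theorem Ladder.precomp_left {w w' z : E} (v : w ⟶ w') (t : Zigzag S w' z) :
    Ladder v (precomp v t) t := by
  have refl : ∀ {x z : E} (t : Zigzag S x z), Ladder (𝟙 x) t t := by
    intro x z t
    induction t with
    | single g => exact .single _ _ _ (by simp)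
    | cons g f hf t ih =>
      exact .cons _ _ _ _ _ _ _ (𝟙 _) (Plus.id _) (𝟙 _) (Plus.id _) (by simp) (by simp) ih
  cases t with
  | single g => exact .single _ _ _ rfl
  | cons g f hf t =>
    exact .cons _ _ _ _ _ _ _ (𝟙 _) (Plus.id _) (𝟙 _) (Plus.id _) (by simp) (by simp) (refl t)

theorem Ladder.refl {w z : E} (t : Zigzag S w z) : Ladder (𝟙 w) t t := by
  have h := Ladder.precomp_left (𝟙 w) t
  rwa [precomp_id] at h

theorem Ladder.append_right {w w' z z' : E} {v : w ⟶ w'} {s : Zigzag S w z} {t : Zigzag S w' z}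
    (h : Ladder v s t) (r : Zigzag S z z') : Ladder v (append s r) (append t r) := by
  induction h with
  | single v g g' hg =>
    subst hg
    simp only [append]
    rw [← precomp_precomp]
    exact Ladder.precomp_left _ _
  | cons v g g' f f' hf hf' u hu v' hv' hg hfu h ih =>
    exact .cons _ _ _ _ _ _ _ u hu v' hv' hg hfu (ih r)

theorem Horizontal.append_right {w z z' : E} {s t : Zigzag S w z} (h : Horizontal s t)
    (r : Zigzag S z z') : Horizontal (append s r) (append t r) := by
  induction h with
  | backward g t =>
    rw [precomp_append]
    exact .backward _ _
  | forward g f hf f' hf' h t => exact .forward _ _ _ _ _ h _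
  | cons g f hf h ih => exact .cons _ _ _ (ih r)

theorem Rel.append_right {w z z' : E} {s t : Zigzag S w z} (h : Rel s t) (r : Zigzag S z z') :
    Rel (append s r) (append t r) :=
  h.imp (fun h => h.append_right r) (fun h => Ladder.append_right h r)

theorem Horizontal.precomp {w w' z : E} (g : w ⟶ w') {s t : Zigzag S w' z} (h : Horizontal s t) :
    Horizontal (precomp g s) (precomp g t) := by
  cases h with
  | backward g' t =>
    rw [precomp_precomp]
    exact .backward _ _
  | forward g' f hf f' hf' h t => exact .forward _ _ _ _ _ h _
  | cons g' f hf h => exact .cons _ _ _ h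

theorem Vertical.precomp {w w' z : E} (g : w ⟶ w') {s t : Zigzag S w' z} (h : Vertical s t) :
    Vertical (precomp g s) (precomp g t) := by
  cases h with
  | single _ g' g'' hg => exact .single _ _ _ (by simp [hg])
  | cons _ g' g'' f f' hf hf' u hu v' hv' hg hfu h =>
    exact .cons _ _ _ _ _ _ _ u hu v' hv' (by simpa using congrArg (g ≫ ·) hg) hfu h

theorem Rel.append_left {w w' z : E} (r : Zigzag S w w') {s t : Zigzag S w' z} (h : Rel s t) :
    Rel (append r s) (append r t) := by
  induction r with
  | single g => exact h.imp (fun h => h.precomp g) (fun h => h.precomp g)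
  | cons g f hf r ih =>
    refine (ih h).imp (fun h => .cons _ _ _ h) (fun h => ?_)
    exact .cons _ _ _ _ _ _ _ (𝟙 _) (Plus.id _) (𝟙 _) (Plus.id _) (by simp) (by simp) h

end Zigzag

/-- The objects of the localization at `S`: those of the original category. -/
structure Loc (S : MorphismProperty E) where
  /-- The underlying object. -/
  obj : E

/-- The morphisms of the localization: zigzags modulo the equivalence relation generated by the
horizontal and vertical relations (`Quot` divides by the generated equivalence relation). -/
def LocHom (S : MorphismProperty E) (w z : E) : Type (max u v) :=
  Quot (Zigzag.Rel (S := S) (w := w) (z := z))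

/-- Composition of classes of zigzags by concatenation of representatives. -/
def LocHom.comp {a b c : E} (γ : LocHom S a b) (δ : LocHom S b c) : LocHom S a c :=
  Quot.map₂ Zigzag.append (fun r _ _ h => Zigzag.Rel.append_left r h)
    (fun _ _ r h => Zigzag.Rel.append_right h r) γ δ

/-- The localization of a category at `S`. -/
instance Loc.category (S : MorphismProperty E) : Category.{max u v} (Loc S) where
  Hom w z := LocHom S w.obj z.obj
  id w := Quot.mk _ (Zigzag.single (𝟙 w.obj))
  comp γ δ := LocHom.comp γ δ
  id_comp := by
    rintro w z ⟨t⟩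
    exact congrArg (Quot.mk _) (Zigzag.precomp_id t)
  comp_id := by
    rintro w z ⟨t⟩
    exact congrArg (Quot.mk _) (Zigzag.append_id t)
  assoc := by
    rintro a b c d ⟨r⟩ ⟨s⟩ ⟨t⟩
    exact congrArg (Quot.mk _) (Zigzag.append_assoc r s t)

/-- The morphism of the localization that a zigzag represents. -/
def Zigzag.toLoc {w z : Loc S} (t : Zigzag S w.obj z.obj) : w ⟶ z :=
  (Quot.mk _ t : LocHom S w.obj z.obj)

end Localization

/-! ### The discrete flow category and sequence representations -/

section Flow

open Topology

variable {X : Type u} [TopologicalSpace X] [T2Space X] {C : Set X} [CWComplex C]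

/-- The Morse system induced by `f`: the morphisms `(y > x)` of the entrance path category for
which `{x, y}` is a regular pair. -/
def morseSystem (f : Cell C → ℝ) : MorphismProperty (Ent (Cell C)) :=
  fun y x g => Ent.seq g = [y.cell, x.cell] ∧ IsRegularPair f x.cell y.cell

/-- The discrete flow category of `f`: the full subcategory of the localization of the entrance
path category at the Morse system whose objects are the critical cells. -/
abbrev Flo (f : Cell C → ℝ) : Type u :=
  ObjectProperty.FullSubcategory (C := Loc (morseSystem f)) (fun x => IsCritical f x.obj.cell)

/-- The critical cell underlying an object of the discrete flow category. -/
def Flo.cell {f : Cell C → ℝ} (w : Flo f) : Cell C := w.obj.obj.cell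

/-- The sequence of cells of a zigzag: the concatenation of the descending sequences of its
forward arrows. -/
def Zigzag.cells {P : Type u} [PartialOrder P] {S : MorphismProperty (Ent P)} :
    {w z : Ent P} → Zigzag S w z → List P
  | _, _, .single g => Ent.seq g
  | _, _, .cons g _ _ t => Ent.seq g ++ Zigzag.cells t

/-- The sequence of cells `s` represents the morphism `γ` of the discrete flow category: it is the
sequence of cells of some zigzag in the class `γ`. -/
def Represents {f : Cell C → ℝ} {w z : Flo f} (s : List (Cell C)) (γ : w ⟶ z) : Prop :=
  ∃ t : Zigzag (morseSystem f) w.obj.obj z.obj.obj, Zigzag.toLoc t = γ.hom ∧ t.cells = s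

/-- The directed graph on the cells with an edge from `u` to `v` if `v` is a proper face of `u` or
`{u, v}` is a regular pair. -/
def flowGraph (f : Cell C → ℝ) : Digraph (Cell C) where
  Adj u v := v < u ∨ IsRegularPair f u v ∨ IsRegularPair f v u

end Flow

/-- `s` is the sequence of vertices of a simple directed path from `w` to `z` in `G`. -/
def IsSimplePath {V : Type u} (G : Digraph V) (w z : V) (s : List V) : Prop :=
  s.head? = some w ∧ s.getLast? = some z ∧ s.IsChain G.Adj ∧ s.Nodup

end DiscreteFlow

namespace DiscreteFlow

/-! ### Reduction of sequences -/

section Reduction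

variable {P : Type u} (R : P → P → Prop)

/-! The category `Ent` is free on the graph of strict face relations, and `Σ` consists of generating
edges. Inverting them works as in a free group: a morphism of the localization is a walk that goes
down along faces and up along regular pairs, modulo cancelling a step along a pair against its
reverse. Every class contains exactly one reduced walk: existence is `IsEdgeClass.exists_reduced`,
and uniqueness follows because zigzags act on reduced lists through `push`, so that `reduction`
respects both generating relations (`IsEdgeClass.reduction_eq_of_rel`).

Reduced walks are exactly the simple ones. A simple walk cannot backtrack. Conversely, suppose that
no cell is the top of one regular pair and the bottom of another. Then no two upward steps are
adjacent, and from a cell that is left downwards all later cells are smaller in the lexicographic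
order of (dimension, value of `f`); this excludes returns (`IsMorseMatching.nodup`).

Doubly paired cells are excluded by the diamond property: between `x < y < z` of consecutive
dimensions there is a second cell `y'`, and `f x < f y' < f z ≤ f y ≤ f x` is absurd. The diamond
property is topology: the boundary of `z` is a sphere, and if `y` were the only cell in between,
this sphere would near a point of the open cell `x` lie inside the closed cell `y`, with that point
on the boundary of `y`, against invariance of domain. Invariance of domain is derived from Brouwer's
theorem, and that from the absence of a `C¹` retraction of a ball onto its sphere. -/

/-- A list is reduced if neighbours differ and no entry is followed by an `R`-related one and then
by itself again. -/
def Reduced : List P → Prop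
  | [] => True
  | [_] => True
  | [x, y] => x ≠ y
  | x :: y :: z :: l => x ≠ y ∧ ¬ (z = x ∧ (R x y ∨ R y x)) ∧ Reduced (y :: z :: l)

open Classical in
/-- Puts `x` in front of a list, cancelling repetitions and backtracking along `R`. -/
noncomputable def push (x : P) : List P → List P
  | [] => [x]
  | [y] => if x = y then [y] else [x, y]
  | y :: z :: l =>
    if x = y then y :: z :: l else if z = x ∧ (R x y ∨ R y x) then z :: l else x :: y :: z :: l

/-- The reduced form of a list. -/
noncomputable def reduction (l : List P) : List P := l.foldr (push R) []

variable {R}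

theorem Reduced.tail {x : P} {l : List P} (h : Reduced R (x :: l)) : Reduced R l := by
  match l with
  | [] => trivial
  | [_] => trivial
  | y :: z :: l => exact h.2.2

theorem Reduced.head_ne {x y : P} {l : List P} (h : Reduced R (x :: y :: l)) : x ≠ y := by
  match l with
  | [] => exact h
  | z :: l => exact h.1

theorem push_self (x : P) (l : List P) : push R x (x :: l) = x :: l := by
  cases l <;> simp [push]

theorem push_eq_cons (x : P) (l : List P) : ∃ l', push R x l = x :: l' := by
  match l with
  | [] => exact ⟨_, rfl⟩
  | [y] =>
    by_cases h : x = y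
    · exact ⟨[], by simp [push, h]⟩
    · exact ⟨[y], by simp [push, h]⟩
  | y :: z :: l =>
    by_cases h : x = y
    · exact ⟨z :: l, by simp [push, h]⟩
    · by_cases h' : z = x ∧ (R x y ∨ R y x)
      · exact ⟨l, by simp [push, h, h']⟩
      · exact ⟨y :: z :: l, by simp only [push, h, h', if_false]⟩

theorem push_push_self (x : P) (l : List P) : push R x (push R x l) = push R x l := by
  obtain ⟨l', h⟩ := push_eq_cons (R := R) x l
  rw [h, push_self]

/-- Either `push` puts the new entry in front, or it cancels a backtracking. -/
theorem push_cases {x y : P} (hxy : x ≠ y) (l : List P) :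
    push R x (y :: l) = x :: y :: l ∨
      ∃ l', l = x :: l' ∧ (R x y ∨ R y x) ∧ push R x (y :: l) = x :: l' := by
  match l with
  | [] => left; simp [push, hxy]
  | z :: l =>
    by_cases h : z = x ∧ (R x y ∨ R y x)
    · obtain ⟨rfl, h'⟩ := h
      exact .inr ⟨l, rfl, h', by simp [push, hxy, h']⟩
    · left
      simp only [push, hxy, h, if_false]

theorem Reduced.push {l : List P} (h : Reduced R l) (x : P) : Reduced R (push R x l) := by
  match l with
  | [] => trivial
  | [y] =>
    by_cases h : x = y
    · simp [DiscreteFlow.push, h, Reduced]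
    · simp [DiscreteFlow.push, h, Reduced]
  | y :: z :: l =>
    by_cases hxy : x = y
    · simpa [DiscreteFlow.push, hxy] using h
    · by_cases h' : z = x ∧ (R x y ∨ R y x)
      · simpa [DiscreteFlow.push, hxy, h'] using h.tail
      · simp only [DiscreteFlow.push, hxy, h', if_false]
        exact ⟨hxy, h', h⟩

theorem Reduced.push_eq {x : P} {l : List P} (h : Reduced R (x :: l)) :
    DiscreteFlow.push R x l = x :: l := by
  match l with
  | [] => rfl
  | [y] => simp [DiscreteFlow.push, show x ≠ y from h]
  | y :: z :: l => simp only [DiscreteFlow.push, h.1, h.2.1, if_false]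

theorem reduced_reduction (l : List P) : Reduced R (reduction R l) := by
  induction l with
  | nil => trivial
  | cons x l ih => exact ih.push x

theorem Reduced.reduction_eq {l : List P} (h : Reduced R l) : reduction R l = l := by
  induction l with
  | nil => rfl
  | cons x l ih =>
    have : reduction R (x :: l) = DiscreteFlow.push R x (reduction R l) := rfl
    rw [this, ih h.tail, h.push_eq]

theorem _root_.List.Nodup.reduced {l : List P} (h : l.Nodup) : Reduced R l := by
  match l with
  | [] => trivial
  | [_] => trivial
  | [x, y] => simpa [Reduced] using h
  | x :: y :: z :: l =>
    refine ⟨by rintro rfl; simp at h, ?_, List.Nodup.reduced (List.nodup_cons.1 h).2⟩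
    rintro ⟨rfl, -⟩
    simp at h

/-- Stepping along an `R`-edge and back does not change a reduced list. -/
theorem Reduced.push_push {x y : P} (hxy : x ≠ y) (hR : R x y ∨ R y x) {l : List P}
    (h : Reduced R (x :: l)) :
    DiscreteFlow.push R x (DiscreteFlow.push R y (x :: l)) = x :: l := by
  -- Either `y` stays in front and pushing `x` cancels it, or `y` already cancels against the list
  -- and pushing `x` restores the original, which is reduced.
  rcases push_cases (R := R) hxy.symm l with h' | ⟨l', rfl, -, h'⟩
  · rw [h']
    simp [DiscreteFlow.push, hxy, hR]
  · rw [h']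
    exact h.push_eq

theorem head?_reduction (l : List P) : (reduction R l).head? = l.head? := by
  cases l with
  | nil => rfl
  | cons x l =>
    obtain ⟨l', h⟩ := push_eq_cons (R := R) x (reduction R l)
    have : reduction R (x :: l) = x :: l' := h
    rw [this]
    rfl

theorem Reduced.foldr_push {l : List P} (hl : Reduced R l) (a : List P) :
    Reduced R (a.foldr (DiscreteFlow.push R) l) := by
  induction a with
  | nil => exact hl
  | cons x a ih => exact ih.push x

theorem reduction_append (a l : List P) :
    reduction R (a ++ l) = a.foldr (push R) (reduction R l) := by
  simp [reduction]

theorem reduction_cons (x : P) (l : List P) :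
    reduction R (x :: l) = push R x (reduction R l) := rfl

end Reduction

/-! ### Descending sequences -/

section Ent

variable {P : Type u} [PartialOrder P]

theorem Ent.seq_id (x : Ent P) : Ent.seq (𝟙 x) = [x.cell] := rfl

theorem Ent.seq_comp {x y z : Ent P} (g : x ⟶ y) (h : y ⟶ z) :
    Ent.seq (g ≫ h) = Ent.seq g ++ (Ent.seq h).tail := rfl

theorem Ent.hom_ext {x y : Ent P} {g h : x ⟶ y} (e : Ent.seq g = Ent.seq h) : g = h :=
  DescSeq.ext e

theorem Ent.head?_seq {x y : Ent P} (g : x ⟶ y) : (Ent.seq g).head? = some x.cell :=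
  DescSeq.head_eq g

theorem Ent.getLast?_seq {x y : Ent P} (g : x ⟶ y) : (Ent.seq g).getLast? = some y.cell :=
  DescSeq.last_eq g

theorem Ent.seq_eq_cons {x y : Ent P} (g : x ⟶ y) : ∃ l, Ent.seq g = x.cell :: l := by
  have h := Ent.head?_seq g
  cases hg : Ent.seq g with
  | nil => simp [hg] at h
  | cons c l =>
    simp only [hg, List.head?_cons, Option.some.injEq] at h
    exact ⟨l, by rw [h]⟩

theorem Ent.seq_eq_concat {x y : Ent P} (g : x ⟶ y) : ∃ l, Ent.seq g = l ++ [y.cell] := by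
  have h := Ent.getLast?_seq g
  rw [List.getLast?_eq_some_iff] at h
  exact h

/-- The morphism given by a single strict face relation. -/
def Ent.edge {x y : Ent P} (h : y.cell < x.cell) : x ⟶ y :=
  (⟨[x.cell, y.cell], by simpa using h, rfl, rfl⟩ : DescSeq x.cell y.cell)

theorem Ent.seq_edge {x y : Ent P} (h : y.cell < x.cell) :
    Ent.seq (Ent.edge h) = [x.cell, y.cell] := rfl

/-- A morphism is an identity or begins with a strict face relation. -/
theorem Ent.eq_edge_comp {x y : Ent P} (g : x ⟶ y) {c : P} {l : List P}
    (hg : Ent.seq g = x.cell :: c :: l) :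
    ∃ (h : c < x.cell) (g' : (⟨c⟩ : Ent P) ⟶ y),
      g = Ent.edge (y := ⟨c⟩) h ≫ g' ∧ Ent.seq g' = c :: l := by
  have hch : (Ent.seq g).IsChain (· > ·) := DescSeq.isChain g
  have hl := Ent.getLast?_seq g
  rw [hg] at hch hl
  refine ⟨(List.isChain_cons_cons.1 hch).1,
    (⟨c :: l, (List.isChain_cons_cons.1 hch).2, rfl, by simpa using hl⟩ : DescSeq c y.cell),
    ?_, rfl⟩
  exact Ent.hom_ext hg

theorem Ent.eq_of_seq_eq_singleton {x y : Ent P} (g : x ⟶ y) {c : P} (hg : Ent.seq g = [c]) :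
    ∃ h : x = y, g = eqToHom h := by
  have h1 := Ent.head?_seq g
  have h2 := Ent.getLast?_seq g
  rw [hg] at h1 h2
  obtain ⟨x⟩ := x
  obtain ⟨y⟩ := y
  obtain rfl : c = x := by simpa using h1
  obtain rfl : c = y := by simpa using h2
  exact ⟨rfl, Ent.hom_ext hg⟩

/-- Induction on morphisms: identities, and a strict face relation followed by a morphism. -/
theorem Ent.hom_induction {y : Ent P} {motive : ∀ x : Ent P, (x ⟶ y) → Prop}
    (id : motive y (𝟙 y))
    (comp : ∀ {x x' : Ent P} (h : x'.cell < x.cell) (g : x' ⟶ y), motive x' g →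
      motive x (Ent.edge h ≫ g)) {x : Ent P} (g : x ⟶ y) : motive x g := by
  obtain ⟨l, hl⟩ := Ent.seq_eq_cons g
  induction l generalizing x with
  | nil =>
    obtain ⟨rfl, rfl⟩ := Ent.eq_of_seq_eq_singleton g hl
    exact id
  | cons c l ih =>
    obtain ⟨h, g', rfl, hg'⟩ := Ent.eq_edge_comp g hl
    exact comp (x' := ⟨c⟩) h g' (ih g' hg')

end Ent

/-! ### Sequences of zigzags -/

section ZigzagCells

variable {P : Type u} [PartialOrder P] {S : MorphismProperty (Ent P)}

namespace Zigzag

theorem cells_eq_cons {w z : Ent P} (t : Zigzag S w z) : ∃ l, t.cells = w.cell :: l := by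
  cases t with
  | single g => exact Ent.seq_eq_cons g
  | cons g f hf t =>
    obtain ⟨l, h⟩ := Ent.seq_eq_cons g
    exact ⟨l ++ t.cells, by simp [cells, h]⟩

theorem head?_cells {w z : Ent P} (t : Zigzag S w z) : t.cells.head? = some w.cell := by
  obtain ⟨l, h⟩ := t.cells_eq_cons
  rw [h]; rfl

theorem getLast?_cells {w z : Ent P} (t : Zigzag S w z) : t.cells.getLast? = some z.cell := by
  induction t with
  | single g => exact Ent.getLast?_seq g
  | cons g f hf t ih => simp [cells, List.getLast?_append, ih]

theorem cells_precomp {w w' z : Ent P} (g : w ⟶ w') (t : Zigzag S w' z) :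
    (precomp g t).cells = Ent.seq g ++ t.cells.tail := by
  cases t with
  | single g' => rfl
  | cons g' f hf t =>
    obtain ⟨l, h⟩ := Ent.seq_eq_cons g'
    simp [precomp, cells, Ent.seq_comp, h]

theorem cells_precomp_edge {w w' z : Ent P} (h : w'.cell < w.cell) (t : Zigzag S w' z) :
    (precomp (Ent.edge h) t).cells = w.cell :: t.cells := by
  obtain ⟨l, hl⟩ := t.cells_eq_cons
  rw [cells_precomp, hl, Ent.seq_edge]
  rfl

theorem cells_cons_id {y x z : Ent P} (f : x ⟶ y) (hf : Plus S f) (t : Zigzag S x z) :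
    (cons (𝟙 y) f hf t).cells = y.cell :: t.cells := rfl

theorem toLoc_eq {w z : Loc S} {s t : Zigzag S w.obj z.obj}
    (h : Relation.EqvGen Rel s t) : toLoc s = toLoc t :=
  Quot.eqvGen_sound h

/-- Going back along a morphism of `Σ⁺` and then forward along it again can be removed. -/
theorem eqvGen_cons_precomp {w y x z : Ent P} (g : w ⟶ y) (f : x ⟶ y) (hf : Plus S f)
    (t : Zigzag S y z) : Relation.EqvGen Rel (cons g f hf (precomp f t)) (precomp g t) := by
  -- The ladder with vertical maps `𝟙 y` and `f` turns the backward `f` into an identity, which is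
  -- then removed.
  refine .trans _ (cons g (𝟙 y) (Plus.id y) t) _ (.rel _ _ (.inr ?_))
    (.rel _ _ (.inl (.backward g t)))
  exact .cons _ _ _ _ _ _ _ (𝟙 _) (Plus.id _) f hf (by simp) (by simp) (Ladder.precomp_left f t)

/-- Going forward along a morphism of `Σ⁺` and then back along it again can be removed. -/
theorem eqvGen_cons_comp {w x y z : Ent P} (g : w ⟶ x) (f : x ⟶ y) (hf : Plus S f)
    (t : Zigzag S x z) : Relation.EqvGen Rel (cons (g ≫ f) f hf t) (precomp g t) := by
  refine .trans _ (cons g (𝟙 x) (Plus.id x) t) _ (.symm _ _ (.rel _ _ (.inr ?_)))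
    (.rel _ _ (.inl (.backward g t)))
  exact .cons _ _ _ _ _ _ _ f hf (𝟙 _) (Plus.id _) (by simp) (by simp) (Ladder.refl t)

theorem eqvGen_append_left {w w' z : Ent P} (r : Zigzag S w w') {s t : Zigzag S w' z}
    (h : Relation.EqvGen Rel s t) : Relation.EqvGen Rel (append r s) (append r t) := by
  induction h with
  | rel s t h => exact .rel _ _ (h.append_left r)
  | refl s => exact .refl _
  | symm s t _ ih => exact .symm _ _ ih
  | trans s t u _ _ ih1 ih2 => exact .trans _ _ _ ih1 ih2

theorem eqvGen_precomp {w w' z : Ent P} (g : w ⟶ w') {s t : Zigzag S w' z}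
    (h : Relation.EqvGen Rel s t) : Relation.EqvGen Rel (precomp g s) (precomp g t) :=
  eqvGen_append_left (single g) h

theorem eqvGen_cons {w y x z : Ent P} (g : w ⟶ y) (f : x ⟶ y) (hf : Plus S f)
    {s t : Zigzag S x z} (h : Relation.EqvGen Rel s t) :
    Relation.EqvGen Rel (cons g f hf s) (cons g f hf t) := by
  have := eqvGen_append_left (cons g f hf (single (𝟙 x))) h
  simpa [append, precomp_id] using this

end Zigzag

variable {R : P → P → Prop}

/-- `S` consists of the one-step sequences `(y > x)` with `R x y`. -/
def IsEdgeClass (S : MorphismProperty (Ent P)) (R : P → P → Prop) : Prop :=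
  ∀ ⦃y x : Ent P⦄ (g : y ⟶ x), S g ↔ Ent.seq g = [y.cell, x.cell] ∧ R x.cell y.cell

variable (hS : IsEdgeClass S R) (hR : ∀ x y, R x y → x < y)

include hS in
theorem IsEdgeClass.plus_seq {y x : Ent P} {f : y ⟶ x} (hf : Plus S f) :
    (∃ h : y = x, f = eqToHom h) ∨
      (Ent.seq f = [y.cell, x.cell] ∧ R x.cell y.cell) := by
  cases hf with
  | of f hf => exact .inr ((hS f).1 hf)
  | id x => exact .inl ⟨rfl, rfl⟩

include hS hR in
/-- Acting with a morphism of `Σ⁺` and with its inverse cancels, in this order. -/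
theorem IsEdgeClass.push_foldr {y x : Ent P} {f : y ⟶ x} (hf : Plus S f) {l : List P}
    (hl : Reduced R l) (hh : l.head? = some x.cell) :
    push R x.cell ((Ent.seq f).foldr (push R) l) = l := by
  obtain ⟨l, rfl⟩ : ∃ l', l = x.cell :: l' := by
    cases l with
    | nil => simp at hh
    | cons c l => exact ⟨l, by simp at hh; rw [hh]⟩
  rcases hS.plus_seq hf with ⟨rfl, rfl⟩ | ⟨h, hr⟩
  · simp [Ent.seq_id, push_self]
  · have hne := (hR _ _ hr).ne
    simp only [h, List.foldr_cons, List.foldr_nil, push_self]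
    exact hl.push_push hne (.inl hr)

include hS hR in
/-- Acting with the inverse of a morphism of `Σ⁺` and with the morphism cancels. -/
theorem IsEdgeClass.foldr_push {y x : Ent P} {f : y ⟶ x} (hf : Plus S f) {l : List P}
    (hl : Reduced R l) (hh : l.head? = some y.cell) :
    (Ent.seq f).foldr (push R) (push R x.cell l) = l := by
  obtain ⟨l, rfl⟩ : ∃ l', l = y.cell :: l' := by
    cases l with
    | nil => simp at hh
    | cons c l => exact ⟨l, by simp at hh; rw [hh]⟩
  rcases hS.plus_seq hf with ⟨rfl, rfl⟩ | ⟨h, hr⟩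
  · simp [Ent.seq_id, push_self]
  · have hne := (hR _ _ hr).ne
    simp only [h, List.foldr_cons, List.foldr_nil, push_push_self]
    exact hl.push_push hne.symm (.inr hr)

/-- Pushing the cells of a morphism is a contravariant action of `Ent` on lists. The middle cell,
pushed twice on the right, is absorbed by `push_push_self`. -/
theorem foldr_push_comp {x y z : Ent P} (g : x ⟶ y) (h : y ⟶ z) (l : List P) :
    (Ent.seq (g ≫ h)).foldr (push R) l =
      (Ent.seq g).foldr (push R) ((Ent.seq h).foldr (push R) l) := by
  obtain ⟨a, ha⟩ := Ent.seq_eq_cons h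
  obtain ⟨b, hb⟩ := Ent.seq_eq_concat g
  simp [Ent.seq_comp, ha, hb, push_push_self]

theorem foldr_push_head? {x y : Ent P} (g : x ⟶ y) (l : List P) :
    ((Ent.seq g).foldr (push R) l).head? = some x.cell := by
  obtain ⟨a, ha⟩ := Ent.seq_eq_cons g
  obtain ⟨l', h⟩ := push_eq_cons (R := R) x.cell (a.foldr (push R) l)
  simp [ha, h]

/-- The cell `y` is already pushed as the end of `g`; repeating it exhibits the factor `push R
y.cell`, which is the action of the inverse of `f`. -/
theorem reduction_cells_cons {w y x z : Ent P} (g : w ⟶ y) (f : x ⟶ y) (hf : Plus S f)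
    (t : Zigzag S x z) : reduction R (Zigzag.cons g f hf t).cells =
      (Ent.seq g).foldr (push R) (push R y.cell (reduction R t.cells)) := by
  obtain ⟨a, ha⟩ := Ent.seq_eq_concat g
  simp [Zigzag.cells, reduction_append, ha, push_push_self, reduction_cons]

theorem reduction_cells_precomp {w w' z : Ent P} (g : w ⟶ w') (t : Zigzag S w' z) :
    reduction R (Zigzag.precomp g t).cells =
      (Ent.seq g).foldr (push R) (reduction R t.cells) := by
  obtain ⟨a, ha⟩ := Ent.seq_eq_concat g
  obtain ⟨l, hl⟩ := t.cells_eq_cons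
  rw [Zigzag.cells_precomp, hl, ha, reduction_append]
  simp [reduction, push_push_self]

theorem head?_reduction_cells {w z : Ent P} (t : Zigzag S w z) :
    (reduction R t.cells).head? = some w.cell := by
  rw [head?_reduction, t.head?_cells]

-- On reduced lists a backward arrow `f` acts by the inverse of its forward action. A commuting
-- square `f ≫ u = v' ≫ f'` can thus be read as `f⁻¹ v' = u f'⁻¹`, and this carries the vertical map
-- through the ladder from right to left.
include hS hR in
theorem IsEdgeClass.reduction_ladder {w w' z : Ent P} {v : w ⟶ w'} {s : Zigzag S w z}
    {t : Zigzag S w' z} (h : Zigzag.Ladder v s t) :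
    reduction R s.cells = (Ent.seq v).foldr (push R) (reduction R t.cells) := by
  induction h with
  | @single w w' z v g g' hg =>
    subst hg
    exact reduction_cells_precomp (S := S) v (.single g')
  | @cons w w' y y' x x' z v g g' f f' hf hf' u hu v' hv' hg hfu t t' h ih =>
    rw [reduction_cells_cons, reduction_cells_cons, ← foldr_push_comp, ← hg, foldr_push_comp]
    congr 1
    rw [ih]
    have hl : Reduced R (push R y'.cell (reduction R t'.cells)) := (reduced_reduction _).push _
    have h1 := hS.push_foldr hR hf (hl.foldr_push (Ent.seq u)) (foldr_push_head? u _)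
    rw [← h1, ← foldr_push_comp, hfu, foldr_push_comp,
      hS.foldr_push hR hf' (reduced_reduction _) (head?_reduction_cells _)]

include hS hR in
theorem IsEdgeClass.reduction_horizontal {w z : Ent P} {s t : Zigzag S w z}
    (h : Zigzag.Horizontal s t) : reduction R s.cells = reduction R t.cells := by
  induction h with
  | backward g t =>
    rw [reduction_cells_cons, reduction_cells_precomp]
    obtain ⟨l, hl⟩ := t.cells_eq_cons
    rw [hl]
    simp [reduction, push_push_self]
  | @forward w y x x' z g f hf f' hf' h t =>
    rw [reduction_cells_cons, reduction_cells_cons, reduction_cells_cons, Ent.seq_id]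
    congr 1
    have hl := reduced_reduction (R := R) t.cells
    have hh := head?_reduction_cells (R := R) t
    set r := reduction R t.cells
    have h1 := hS.foldr_push hR hf' hl hh
    have h2 := hS.foldr_push hR hf (hl.push x.cell)
      (by obtain ⟨l', h⟩ := push_eq_cons (R := R) x.cell r; simp [h])
    -- Pushing `y` inverts the action of `f' ≫ f`, and so does pushing `x` and then `y`, by `h1` and
    -- `h2`; hence the two agree on `r`.
    have h3 := hS.push_foldr hR h ((hl.push x.cell).push y.cell)
      (by obtain ⟨l', h⟩ := push_eq_cons (R := R) y.cell (push R x.cell r); simp [h])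
    rw [foldr_push_comp, h2, h1] at h3
    simpa [push_push_self] using h3.symm
  | cons g f hf h ih => rw [reduction_cells_cons, reduction_cells_cons, ih]

include hS hR in
/-- The reduced sequence of a zigzag is an invariant of its class. -/
theorem IsEdgeClass.reduction_eq_of_rel {w z : Ent P} {s t : Zigzag S w z}
    (h : Zigzag.Rel s t) : reduction R s.cells = reduction R t.cells := by
  rcases h with h | h
  · exact hS.reduction_horizontal hR h
  · rw [hS.reduction_ladder hR h]
    obtain ⟨l, hl⟩ := push_eq_cons (R := R) w.cell (t.cells.tail.foldr (push R) [])
    obtain ⟨l', hl'⟩ := t.cells_eq_cons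
    rw [Ent.seq_id, hl']
    simp [reduction, push_push_self]

include hS hR in
theorem IsEdgeClass.reduction_eq_of_toLoc_eq {w z : Loc S} {s t : Zigzag S w.obj z.obj}
    (h : Zigzag.toLoc s = Zigzag.toLoc t) : reduction R s.cells = reduction R t.cells :=
  congrArg (Quot.lift (fun t : Zigzag S w.obj z.obj => reduction R t.cells)
    (fun _ _ h => hS.reduction_eq_of_rel hR h)) h

include hS in
/-- A zigzag whose sequence starts with `w, c` for `c ≠ w` starts with a step from `w` to `c`. -/
theorem IsEdgeClass.exists_of_cells_eq {w z : Ent P} (t : Zigzag S w z) {c : P} {l : List P}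
    (ht : t.cells = w.cell :: c :: l) (hc : w.cell ≠ c) :
    (∃ (h : c < w.cell) (t' : Zigzag S ⟨c⟩ z),
      t = Zigzag.precomp (Ent.edge (y := ⟨c⟩) h) t' ∧ t'.cells = c :: l) ∨
    (∃ (f : (⟨c⟩ : Ent P) ⟶ w) (hf : Plus S f) (t' : Zigzag S ⟨c⟩ z),
      t = .cons (𝟙 w) f hf t' ∧ t'.cells = c :: l ∧ Ent.seq f = [c, w.cell] ∧ R w.cell c) := by
  cases t with
  | single g =>
    obtain ⟨h, g', rfl, hg'⟩ := Ent.eq_edge_comp g ht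
    exact .inl ⟨h, .single g', rfl, hg'⟩
  | @cons _ y x _ g f hf t =>
    obtain ⟨a, ha⟩ := Ent.seq_eq_cons g
    cases a with
    | nil =>
      obtain ⟨rfl, rfl⟩ := Ent.eq_of_seq_eq_singleton g ha
      have ht' : t.cells = c :: l := by simpa [Zigzag.cells, Ent.seq_id] using ht
      obtain ⟨x⟩ := x
      obtain rfl : x = c := by simpa [ht'] using t.head?_cells.symm
      rcases hS.plus_seq hf with ⟨h, -⟩ | ⟨h, hr⟩
      · exact absurd (congrArg Ent.cell h).symm hc
      · exact .inr ⟨f, hf, t, rfl, ht', h, hr⟩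
    | cons d a =>
      obtain rfl : d = c := by
        have := congrArg (fun l => l[1]?) ht
        simpa [Zigzag.cells, ha] using this
      obtain ⟨h, g', rfl, hg'⟩ := Ent.eq_edge_comp g ha
      refine .inl ⟨h, .cons g' f hf t, rfl, ?_⟩
      simpa [Zigzag.cells, hg', ha] using ht

include hS hR in
/-- Zigzags without repetitions are determined by their sequences. -/
theorem IsEdgeClass.eq_of_cells_eq {w z : Ent P} {s t : Zigzag S w z} (hs : Reduced R s.cells)
    (h : s.cells = t.cells) : s = t := by
  obtain ⟨l, hl⟩ := s.cells_eq_cons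
  induction l generalizing w with
  | nil =>
    have key : ∀ s : Zigzag S w z, s.cells = [w.cell] →
        ∃ h : w = z, s = .single (eqToHom h) := by
      intro s hl
      cases s with
      | single g =>
        obtain ⟨rfl, rfl⟩ := Ent.eq_of_seq_eq_singleton g hl
        exact ⟨rfl, rfl⟩
      | cons g f hf t =>
        obtain ⟨a, ha⟩ := Ent.seq_eq_cons g
        obtain ⟨b, hb⟩ := t.cells_eq_cons
        simp [Zigzag.cells, ha, hb] at hl
    obtain ⟨_, h1⟩ := key s hl
    obtain ⟨_, h2⟩ := key t (h ▸ hl)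
    rw [h1, h2]
  | cons c l ih =>
    rw [hl] at hs
    have hc := hs.head_ne
    -- A step goes down or up according to the order of its two cells, so both zigzags take it in
    -- the same direction.
    rcases hS.exists_of_cells_eq s hl hc with ⟨h1, s', rfl, hs'⟩ | ⟨f, hf, s', rfl, hs', hf1, hr⟩
    · rcases hS.exists_of_cells_eq t (h ▸ hl) hc with
        ⟨h2, t', rfl, ht'⟩ | ⟨f, hf, t', rfl, ht', hf1, hr⟩
      · rw [ih (hs' ▸ hs.tail) (hs'.trans ht'.symm) hs']
      · exact absurd h1 (hR _ _ hr).not_gt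
    · rcases hS.exists_of_cells_eq t (h ▸ hl) hc with
        ⟨h2, t', rfl, ht'⟩ | ⟨f', hf', t', rfl, ht', hf2, hr'⟩
      · exact absurd h2 (hR _ _ hr).not_gt
      · obtain rfl : f = f' := Ent.hom_ext (hf1.trans hf2.symm)
        rw [ih (hs' ▸ hs.tail) (hs'.trans ht'.symm) hs']

include hS hR in
/-- Every zigzag is equivalent to one with a reduced sequence. -/
theorem IsEdgeClass.exists_reduced {w z : Ent P} (t : Zigzag S w z) :
    ∃ t' : Zigzag S w z, Relation.EqvGen Zigzag.Rel t t' ∧ Reduced R t'.cells := by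
  -- A zigzag is built from its right end by face steps (`down`) and inverses of arrows in `Σ⁺`
  -- (`up`). By `push_cases`, a nontrivial step put in front of a reduced list either leaves it
  -- reduced or reverses the first step of the zigzag, and then both steps are removed.
  have down : ∀ {w w' : Ent P} (g : w ⟶ w') (t : Zigzag S w' z), Reduced R t.cells →
      ∃ t' : Zigzag S w z, Relation.EqvGen Zigzag.Rel (Zigzag.precomp g t) t' ∧
        Reduced R t'.cells := by
    intro w w' g t ht
    induction g using Ent.hom_induction with
    | id => exact ⟨t, by rw [Zigzag.precomp_id]; exact .refl _, ht⟩
    | @comp x x' h g ih =>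
      obtain ⟨s, hs1, hs⟩ := ih
      rw [← Zigzag.precomp_precomp]
      have hs2 := Zigzag.eqvGen_precomp (Ent.edge h) hs1
      obtain ⟨l, hl⟩ := s.cells_eq_cons
      rcases push_cases (R := R) h.ne' l with hp | ⟨l', rfl, hr, hp⟩
      · refine ⟨_, hs2, ?_⟩
        rw [Zigzag.cells_precomp_edge, hl, ← hp, ← hl]
        exact hs.push _
      · rcases hS.exists_of_cells_eq s hl h.ne with ⟨h', -⟩ | ⟨f, hf, s', rfl, hs', hf1, -⟩
        · exact absurd h' h.not_gt
        · obtain rfl : f = Ent.edge h := Ent.hom_ext hf1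
          refine ⟨s', hs2.trans _ _ _ ?_, ?_⟩
          · have := Zigzag.eqvGen_cons_comp (𝟙 x) _ hf s'
            rw [Zigzag.precomp_id] at this
            simpa [Zigzag.precomp] using this
          · rw [hs']
            exact (hl ▸ hs).tail
  have up : ∀ {y x : Ent P} (f : x ⟶ y) (hf : Plus S f) (t : Zigzag S x z), Reduced R t.cells →
      ∃ t' : Zigzag S y z, Relation.EqvGen Zigzag.Rel (.cons (𝟙 y) f hf t) t' ∧
        Reduced R t'.cells := by
    intro y x f hf t ht
    rcases hS.plus_seq hf with ⟨rfl, rfl⟩ | ⟨h, hr⟩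
    · refine ⟨t, .rel _ _ (.inl ?_), ht⟩
      have := Zigzag.Horizontal.backward (𝟙 x) t
      rwa [Zigzag.precomp_id] at this
    · have hlt := hR _ _ hr
      obtain ⟨l, hl⟩ := t.cells_eq_cons
      rcases push_cases (R := R) hlt.ne l with hp | ⟨l', rfl, hr, hp⟩
      · refine ⟨_, .refl _, ?_⟩
        rw [Zigzag.cells_cons_id, hl, ← hp, ← hl]
        exact ht.push _
      · rcases hS.exists_of_cells_eq t hl hlt.ne' with ⟨h', t', rfl, ht'⟩ | ⟨_, _, _, _, _, _, hr'⟩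
        · obtain rfl : f = Ent.edge h' := Ent.hom_ext h
          refine ⟨t', ?_, ?_⟩
          · have := Zigzag.eqvGen_cons_precomp (𝟙 y) _ hf t'
            rwa [Zigzag.precomp_id] at this
          · rw [ht']
            exact (hl ▸ ht).tail
        · exact absurd (hR _ _ hr') hlt.not_gt
  induction t with
  | single g =>
    obtain ⟨t', h, ht'⟩ := down g (.single (𝟙 _)) trivial
    exact ⟨t', by simpa [Zigzag.precomp] using h, ht'⟩
  | cons g f hf t ih =>
    obtain ⟨t1, h1, ht1⟩ := ih down up
    obtain ⟨t2, h2, ht2⟩ := up f hf t1 ht1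
    obtain ⟨t3, h3, ht3⟩ := down g t2 ht2
    refine ⟨t3, .trans _ _ _ ?_ (.trans _ _ _ (Zigzag.eqvGen_precomp g h2) h3), ht3⟩
    simpa [Zigzag.precomp] using Zigzag.eqvGen_cons g f hf h1

include hS in
/-- The steps of the sequence of a zigzag, if the sequence is reduced. -/
theorem IsEdgeClass.isChain_cells {w z : Ent P} (t : Zigzag S w z) (ht : Reduced R t.cells) :
    t.cells.IsChain (fun u v => v < u ∨ R u v) := by
  obtain ⟨l, hl⟩ := t.cells_eq_cons
  induction l generalizing w with
  | nil => simp [hl]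
  | cons c l ih =>
    rw [hl] at ht ⊢
    rcases hS.exists_of_cells_eq t hl ht.head_ne with ⟨h, t', -, ht'⟩ | ⟨_, _, t', -, ht', -, hr⟩
    · exact List.isChain_cons_cons.2 ⟨.inl h, ht' ▸ ih t' (ht' ▸ ht.tail) ht'⟩
    · exact List.isChain_cons_cons.2 ⟨.inr hr, ht' ▸ ih t' (ht' ▸ ht.tail) ht'⟩

include hS hR in
/-- A sequence of steps is the sequence of some zigzag. -/
theorem IsEdgeClass.exists_cells_eq {w z : Ent P} {s : List P}
    (hh : s.head? = some w.cell) (hl : s.getLast? = some z.cell)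
    (hs : s.IsChain (fun u v => v < u ∨ R u v)) : ∃ t : Zigzag S w z, t.cells = s := by
  induction s generalizing w with
  | nil => simp at hh
  | cons a s ih =>
    obtain ⟨w⟩ := w
    obtain rfl : a = w := by simpa using hh
    cases s with
    | nil =>
      obtain ⟨z⟩ := z
      obtain rfl : a = z := by simpa using hl
      exact ⟨.single (𝟙 _), rfl⟩
    | cons b s =>
      rw [List.isChain_cons_cons] at hs
      obtain ⟨t, ht⟩ := ih (w := (⟨b⟩ : Ent P)) rfl (by simpa using hl) hs.2
      rcases hs.1 with h | h
      · exact ⟨Zigzag.precomp (Ent.edge (x := ⟨a⟩) (y := ⟨b⟩) h) t, by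
          rw [Zigzag.cells_precomp_edge, ht]⟩
      · refine ⟨Zigzag.cons (𝟙 (⟨a⟩ : Ent P)) (Ent.edge (x := ⟨b⟩) (y := ⟨a⟩) (hR _ _ h))
          (.of _ ?_) t, ?_⟩
        · exact (hS _).2 ⟨rfl, h⟩
        · rw [Zigzag.cells_cons_id, ht]

end ZigzagCells

/-! ### Acyclicity of reduced walks -/

section Acyclic

variable {P : Type u} [PartialOrder P] {dim : P → ℕ} {f : P → ℝ} {R : P → P → Prop}

/-- The combinatorial properties of the regular pairs of a discrete Morse function that make
reduced walks simple. -/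
structure IsMorseMatching (dim : P → ℕ) (f : P → ℝ) (R : P → P → Prop) : Prop where
  dim_lt : ∀ {x y}, x < y → dim x < dim y
  dim_eq : ∀ {x y}, R x y → dim y = dim x + 1
  lt : ∀ {x y}, R x y → x < y
  le : ∀ {x y}, R x y → f y ≤ f x
  up : ∀ {x y y'}, R x y → x < y' → dim y' = dim x + 1 → y' ≠ y → f x < f y'
  not_top : ∀ {x y z}, R x y → ¬ R y z

/-- Along a reduced walk that starts with a step down, all later cells have smaller dimension, or
the same dimension and a smaller value. -/
theorem IsMorseMatching.lt_of_mem (h : IsMorseMatching dim f R) (a : P) (l : List P)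
    (hl : (a :: l).IsChain (fun u v => v < u ∨ R u v)) (hr : Reduced R (a :: l))
    (hd : ∀ b ∈ l.head?, b < a) (c : P) (hc : c ∈ l) :
    dim c < dim a ∨ (dim c = dim a ∧ f c < f a) := by
  induction hn : l.length using Nat.strong_induction_on generalizing a l with | _ n ih
  match l with
  | [] => simp at hc
  | b :: l =>
    have hba : b < a := hd b rfl
    have hdim := h.dim_lt hba
    rw [List.isChain_cons_cons] at hl
    rcases List.mem_cons.1 hc with rfl | hc
    · exact .inl hdim
    match l with
    | [] => simp at hc
    | b' :: l =>
      rcases (List.isChain_cons_cons.1 hl.2).1 with hb | hb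
      · have := ih _ (by simp [← hn]) b (b' :: l) hl.2 hr.tail (by simpa using hb) hc rfl
        left
        omega
      -- The walk dips to `b` and rises to the partner `b'` of `b`. By `not_top` it must then go
      -- down, so induction applies from `b'`; reducedness gives `b' ≠ a`.
      · have hd' : ∀ d ∈ l.head?, d < b' := by
          intro d hd'
          match l with
          | [] => simp at hd'
          | e :: l =>
            obtain rfl : e = d := by simpa using hd'
            exact ((List.isChain_cons_cons.1 (List.isChain_cons_cons.1 hl.2).2).1).resolve_right
              (h.not_top hb)
        have hne : b' ≠ a := fun e => hr.2.1 ⟨e, .inr (e ▸ hb)⟩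
        have hdb := h.dim_eq hb
        have key : dim c < dim b' ∨ (dim c = dim b' ∧ f c ≤ f b') := by
          rcases List.mem_cons.1 hc with rfl | hc
          · exact .inr ⟨rfl, le_rfl⟩
          · exact (ih _ (by simp [← hn]) b' l (List.isChain_cons_cons.1 hl.2).2 hr.tail.tail hd' hc
              rfl).imp
              id (fun h => ⟨h.1, h.2.le⟩)
        -- If `a` has the dimension of `b'`, it is a coface of `b` other than its partner, so `f b'
        -- ≤ f b < f a`. Otherwise the dimension has already dropped.
        by_cases hda : dim a = dim b + 1
        · have h1 := h.up hb hba hda hne.symm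
          have h2 := h.le hb
          rcases key with key | ⟨k1, k2⟩
          · left; omega
          · right; exact ⟨by omega, by linarith⟩
        · left
          rcases key with key | ⟨k1, k2⟩ <;> omega

/-- If the walk leaves `a` downwards, `lt_of_mem` forbids a return. If it rises to the partner `b`,
a return would arrive from some coface `u` of `a`, since `a` is no top. Descent from `b` forces `dim
u = dim b` and `f u < f b ≤ f a`, whereas `u ≠ b` gives `f a < f u`. -/
theorem IsMorseMatching.not_mem (h : IsMorseMatching dim f R) (a : P) (l : List P)
    (hl : (a :: l).IsChain (fun u v => v < u ∨ R u v)) (hr : Reduced R (a :: l)) : a ∉ l := by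
  have down : ∀ (a : P) (l : List P), (a :: l).IsChain (fun u v => v < u ∨ R u v) →
      Reduced R (a :: l) → (∀ b ∈ l.head?, b < a) → a ∉ l := by
    intro a l hl hr hd ha
    rcases h.lt_of_mem a l hl hr hd a ha with h | h
    · exact lt_irrefl _ h
    · exact lt_irrefl _ h.2
  intro ha
  match l with
  | [] => simp at ha
  | b :: l =>
    rcases (List.isChain_cons_cons.1 hl).1 with hb | hb
    · exact down a (b :: l) hl hr (by simpa using hb) ha
    have hl' := (List.isChain_cons_cons.1 hl).2
    have hd : ∀ d ∈ l.head?, d < b := by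
      intro d hd
      match l with
      | [] => simp at hd
      | e :: l =>
        obtain rfl : e = d := by simpa using hd
        exact (List.isChain_cons_cons.1 hl').1.resolve_right (h.not_top hb)
    rcases List.mem_cons.1 ha with rfl | ha
    · exact lt_irrefl _ (h.lt hb)
    obtain ⟨l₁, l₂, rfl⟩ := List.append_of_mem ha
    rcases List.eq_nil_or_concat l₁ with rfl | ⟨l₁, u, rfl⟩
    · exact hr.2.1 ⟨rfl, .inl hb⟩
    have hu : u ∈ l₁.concat u ++ a :: l₂ := by simp
    have hstep : a < u ∨ R u a := by
      have : (b :: l₁ ++ (u :: a :: l₂)).IsChain (fun u v => v < u ∨ R u v) := by simpa using hl'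
      exact (List.isChain_cons_cons.1 (List.isChain_append.1 this).2.1).1
    have hub : u ≠ b := fun e => down b _ hl' hr.tail hd (e ▸ hu)
    have hau := hstep.resolve_right (fun h' => h.not_top h' hb)
    have h1 := h.dim_lt hau
    have h2 := h.dim_eq hb
    rcases h.lt_of_mem b _ hl' hr.tail hd u hu with h3 | h3
    · omega
    · have h4 := h.up hb hau (by omega) hub
      have h5 := h.le hb
      linarith

/-- Reduced walks are simple. -/
theorem IsMorseMatching.nodup (h : IsMorseMatching dim f R) {l : List P}
    (hl : l.IsChain (fun u v => v < u ∨ R u v)) (hr : Reduced R l) : l.Nodup := by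
  induction l with
  | nil => exact List.nodup_nil
  | cons a l ih => exact List.nodup_cons.2 ⟨h.not_mem a l hl hr, ih hl.tail hr.tail⟩

end Acyclic

/-! ### Simple paths of cells and morphisms of the flow category -/

section Paths

open Topology

variable {X : Type u} [TopologicalSpace X] [T2Space X] {C : Set X} [CWComplex C]

/-- If `dim y ≤ dim x`, the boundary of `y` lies in a skeleton too low to meet the open cell `x`,
and distinct open cells are disjoint. -/
theorem Cell.dim_lt_of_lt {x y : Cell C} (h : x < y) : x.dim < y.dim := by
  by_contra hd
  rw [not_lt] at hd
  have hne : (⟨y.dim, y.idx⟩ : Σ n, RelCWComplex.cell C n) ≠ ⟨x.dim, x.idx⟩ := by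
    intro e
    apply h.ne
    obtain ⟨n, i⟩ := x
    obtain ⟨m, j⟩ := y
    cases e
    rfl
  obtain ⟨p, hp⟩ := RelCWComplex.openCell_nonempty x.dim x.idx
  have hpy : p ∈ RelCWComplex.closedCell y.dim y.idx :=
    h.le (RelCWComplex.openCell_subset_closedCell _ _ hp)
  rw [← RelCWComplex.cellFrontier_union_openCell_eq_closedCell] at hpy
  rcases hpy with hpy | hpy
  · exact Set.disjoint_left.1 (RelCWComplex.disjoint_skeletonLT_openCell le_rfl)
      (RelCWComplex.skeletonLT_mono (Nat.cast_le.2 hd)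
        (RelCWComplex.cellFrontier_subset_skeletonLT _ _ hpy)) hp
  · exact Set.disjoint_left.1 (RelCWComplex.disjoint_openCell_of_ne hne) hpy hp

variable {f : Cell C → ℝ}

theorem IsRegularPair.lt {x y : Cell C} (h : IsRegularPair f x y) : x < y := by
  refine lt_of_le_of_ne h.2.1 ?_
  rintro rfl
  have := h.1
  omega

theorem isEdgeClass_morseSystem (f : Cell C → ℝ) :
    IsEdgeClass (morseSystem f) (IsRegularPair f) := fun _ _ _ => Iff.rfl

/-- If no cell is both the upper and the lower cell of a regular pair, the regular pairs satisfy
the conditions for reduced walks to be simple. -/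
theorem IsDiscreteMorse.isMorseMatching (hf : IsDiscreteMorse f)
    (h : ∀ x y z : Cell C, IsRegularPair f x y → ¬ IsRegularPair f y z) :
    IsMorseMatching Cell.dim f (IsRegularPair f) where
  dim_lt := Cell.dim_lt_of_lt
  dim_eq h := h.1
  lt h := h.lt
  le h := h.2.2
  up {x y y'} hxy hlt hd hne := by
    by_contra hle
    exact hne ((hf x).1 ⟨hd, hlt.le, not_lt.1 hle⟩ hxy)
  not_top hxy := h _ _ _ hxy

theorem flowGraph_adj_iff {u v : Cell C} :
    (flowGraph f).Adj u v ↔ v < u ∨ IsRegularPair f u v := by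
  constructor
  · rintro (h | h | h)
    · exact .inl h
    · exact .inr h
    · exact .inl h.lt
  · exact fun h => h.imp id .inl

/-- A walk is simple if and only if it is reduced, so the simple path of a morphism is its reduced
form. A reduced list determines even the zigzag itself, which gives uniqueness in the converse
direction. -/
theorem existsUnique_simplePath
    (h : IsMorseMatching Cell.dim f (IsRegularPair f)) (w z : Flo f) :
    (∀ γ : w ⟶ z, ∃! s : List (Cell C),
      IsSimplePath (flowGraph f) w.cell z.cell s ∧ Represents s γ) ∧
    (∀ s : List (Cell C), IsSimplePath (flowGraph f) w.cell z.cell s →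
        ∃! γ : w ⟶ z, Represents s γ) := by
  have hS := isEdgeClass_morseSystem f
  have hR : ∀ x y : Cell C, IsRegularPair f x y → x < y := fun _ _ h => h.lt
  have hadj : (flowGraph f).Adj = fun u v => v < u ∨ IsRegularPair f u v := by
    ext u v
    exact flowGraph_adj_iff
  constructor
  · intro γ
    obtain ⟨t, ht⟩ := Quot.exists_rep γ.hom
    obtain ⟨t', htt, ht'⟩ := hS.exists_reduced hR t
    have hch := hS.isChain_cells t' ht'
    refine ⟨t'.cells, ⟨⟨t'.head?_cells, t'.getLast?_cells, ?_, h.nodup hch ht'⟩, t', ?_, rfl⟩, ?_⟩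
    · rw [hadj]; exact hch
    · rw [← Zigzag.toLoc_eq htt]; exact ht
    · rintro s ⟨⟨-, -, -, hs⟩, t₁, ht₁, rfl⟩
      rw [← hs.reduced.reduction_eq (R := IsRegularPair f), ← ht'.reduction_eq]
      apply hS.reduction_eq_of_toLoc_eq hR
      rw [ht₁, ← Zigzag.toLoc_eq htt]
      exact ht.symm
  · rintro s ⟨hh, hl, hc, hn⟩
    rw [hadj] at hc
    obtain ⟨t, rfl⟩ := hS.exists_cells_eq hR (w := w.obj.obj) (z := z.obj.obj) hh hl hc
    refine ⟨⟨Zigzag.toLoc t⟩, ⟨t, rfl, rfl⟩, ?_⟩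
    rintro γ ⟨t', ht', hcells⟩
    obtain rfl := hS.eq_of_cells_eq hR hn.reduced hcells.symm
    ext
    exact ht'.symm

end Paths

/-! ### A no-retraction theorem -/

section NoRetraction

open Metric Set MeasureTheory Filter Topology

/-- The determinant of `1 + t A` is a polynomial in `t`, of degree at most the dimension. -/
theorem det_one_add_smul_eq_sum {E : Type*} [NormedAddCommGroup E] [NormedSpace ℝ E]
    [FiniteDimensional ℝ E] (s : Finset ℝ) (hs : Module.finrank ℝ E < s.card) (A : E →L[ℝ] E)
    (t : ℝ) : (1 + t • A).det =
      ∑ i ∈ s, (1 + i • A).det * (Lagrange.basis s id i).eval t := by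
  let b := Module.finBasis ℝ E
  let M := LinearMap.toMatrix b b (A : E →ₗ[ℝ] E)
  let p : Polynomial ℝ := ((Polynomial.X : Polynomial ℝ) • M.map Polynomial.C +
    (1 : Matrix _ _ ℝ).map Polynomial.C).det
  have hp : ∀ t : ℝ, p.eval t = (1 + t • A).det := by
    intro t
    have h1 : (1 + t • A).det = (t • M + 1).det := by
      rw [ContinuousLinearMap.det, ← LinearMap.det_toMatrix b]
      congr 1
      have : ((1 + t • A : E →L[ℝ] E) : E →ₗ[ℝ] E) = t • (A : E →ₗ[ℝ] E) + LinearMap.id := by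
        ext x
        simp [add_comm]
      rw [this, map_add, map_smul, LinearMap.toMatrix_id]
    rw [h1, ← Polynomial.coe_evalRingHom, RingHom.map_det]
    congr 1
    ext i j
    by_cases hij : i = j
    · subst hij
      simp [mul_comm t]
    · simp [Matrix.one_apply_ne hij, mul_comm t]
  -- Interpolation at more nodes than the degree recovers the polynomial. Expanding in values rather
  -- than coefficients is useful because the integrals of the values at small nodes are known.
  have hdeg : p.degree < s.card := by
    have h1 : p.natDegree ≤ Fintype.card (Fin (Module.finrank ℝ E)) :=
      Polynomial.natDegree_det_X_add_C_le _ _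
    rw [Fintype.card_fin] at h1
    exact lt_of_le_of_lt Polynomial.degree_le_natDegree (by exact_mod_cast lt_of_le_of_lt h1 hs)
  have h := Lagrange.eq_interpolate (v := (id : ℝ → ℝ)) (s := s) Function.injective_id.injOn hdeg
  rw [← hp t, h, Lagrange.interpolate_apply, Polynomial.eval_finsetSum]
  refine Finset.sum_congr rfl fun i _ => ?_
  rw [Polynomial.eval_mul, Polynomial.eval_C, hp]
  rfl

variable {E : Type*} [NormedAddCommGroup E] [NormedSpace ℝ E] [FiniteDimensional ℝ E]

/-- The determinant is `1` at parameter `0`. A sign change before `t` would give a nonzero `v` with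
`v = -s • A v`, impossible for `s * ‖A‖ < 1`. -/
theorem det_one_add_smul_pos {A : E →L[ℝ] E} {t : ℝ} (ht : 0 ≤ t) (h : t * ‖A‖ < 1) :
    0 < (1 + t • A).det := by
  by_contra hle
  have hc : Continuous fun s : ℝ => (1 + s • A).det := by
    have : Continuous fun s : ℝ => 1 + s • A := by fun_prop
    exact ContinuousLinearMap.continuous_det.comp this
  obtain ⟨s, ⟨hs0, hst⟩, hs⟩ := intermediate_value_Icc' ht hc.continuousOn
    (show (0 : ℝ) ∈ Icc _ _ from ⟨not_lt.1 hle, by simp [ContinuousLinearMap.det]⟩)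
  have hker := LinearMap.bot_lt_ker_of_det_eq_zero hs
  obtain ⟨v, hv, hv0⟩ := (Submodule.ne_bot_iff _).1 hker.ne'
  have hv' : v + s • A v = 0 := by simpa using hv
  have h1 : ‖v‖ ≤ s * (‖A‖ * ‖v‖) := by
    calc ‖v‖ = s * ‖A v‖ := by
          conv_lhs => rw [eq_neg_of_add_eq_zero_left hv', norm_neg, norm_smul,
            Real.norm_of_nonneg hs0]
      _ ≤ s * (‖A‖ * ‖v‖) := mul_le_mul_of_nonneg_left (A.le_opNorm v) hs0
  have h2 : s * ‖A‖ ≤ t * ‖A‖ := mul_le_mul_of_nonneg_right hst (norm_nonneg _)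
  have h3 : 0 < ‖v‖ := norm_pos_iff.2 hv0
  nlinarith

variable [MeasurableSpace E] [BorelSpace E]

/-- If `K` is Lipschitz, differentiable in a ball and zero outside of it, then the integral over
the ball of the Jacobian determinant of `id + t K` does not depend on `t`. -/
theorem integral_det_one_add_smul_fderiv (μ : Measure E) [μ.IsAddHaarMeasure] {K : E → E}
    {L : NNReal} (hK : LipschitzWith L K) {r : ℝ} (h0 : ∀ x, r ≤ ‖x‖ → K x = 0)
    (hd : DifferentiableOn ℝ K (ball 0 r)) (t : ℝ) :
    ∫ x in ball (0 : E) r, (1 + t • fderiv ℝ K x).det ∂μ = μ.real (ball 0 r) := by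
  -- For `t * L < 1` the map `id + t K` is a Lipschitz perturbation of the identity, hence
  -- bijective. It fixes the outside of the ball, so it maps the ball onto itself, and the change of
  -- variables formula gives the volume.
  have small : ∀ t : ℝ, 0 ≤ t → t * L < 1 →
      IntegrableOn (fun x => (1 + t • fderiv ℝ K x).det) (ball (0 : E) r) μ ∧
      ∫ x in ball (0 : E) r, (1 + t • fderiv ℝ K x).det ∂μ = μ.real (ball 0 r) := by
    intro t ht htL
    let φ : E → E := fun x => x + t • K x
    have hlip : LipschitzWith (Real.toNNReal t * L) fun x => t • K x := by
      refine LipschitzWith.of_dist_le_mul fun x y => ?_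
      rw [dist_smul₀, Real.norm_of_nonneg ht, NNReal.coe_mul, Real.coe_toNNReal t ht, mul_assoc]
      exact mul_le_mul_of_nonneg_left (hK.dist_le_mul x y) ht
    have hφ : ApproximatesLinearOn φ
        ((ContinuousLinearEquiv.refl ℝ E : E ≃L[ℝ] E) : E →L[ℝ] E) univ (Real.toNNReal t * L) := by
      rw [ApproximatesLinearOn.approximatesLinearOn_iff_lipschitzOnWith]
      convert! hlip.lipschitzOnWith (s := univ) using 1
      ext x
      simp [φ]
    have hbij : Function.Bijective φ := by
      have hc : Subsingleton E ∨ Real.toNNReal t * L <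
          ‖((ContinuousLinearEquiv.refl ℝ E).symm : E →L[ℝ] E)‖₊⁻¹ := by
        rcases subsingleton_or_nontrivial E with h | h
        · exact .inl h
        · right
          have : ‖((ContinuousLinearEquiv.refl ℝ E).symm : E →L[ℝ] E)‖₊ = 1 :=
            ContinuousLinearMap.nnnorm_id
          rw [this, inv_one, ← NNReal.coe_lt_coe, NNReal.coe_mul, Real.coe_toNNReal t ht]
          exact htL
      exact ⟨injOn_univ.1 (hφ.injOn hc), hφ.surjective hc⟩
    have hout : ∀ x, r ≤ ‖x‖ → φ x = x := fun x hx => by simp [φ, h0 x hx]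
    have himg : φ '' ball 0 r = ball 0 r := by
      apply Subset.antisymm
      · rintro _ ⟨x, hx, rfl⟩
        by_contra h
        rw [mem_ball_zero_iff, not_lt] at h
        have := hbij.1 (hout _ h)
        rw [this] at h
        rw [mem_ball_zero_iff] at hx
        linarith
      · intro y hy
        obtain ⟨x, rfl⟩ := hbij.2 y
        refine ⟨x, ?_, rfl⟩
        by_contra h
        rw [mem_ball_zero_iff, not_lt] at h
        rw [hout x h, mem_ball_zero_iff] at hy
        linarith
    have hder : ∀ x ∈ ball (0 : E) r,
        HasFDerivWithinAt φ (1 + t • fderiv ℝ K x) (ball 0 r) x := by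
      intro x hx
      have h1 := ((hd x hx).differentiableAt (isOpen_ball.mem_nhds hx)).hasFDerivAt
      exact ((hasFDerivAt_id x).add (h1.const_smul t)).hasFDerivWithinAt
    have hpos : ∀ x, |(1 + t • fderiv ℝ K x).det| = (1 + t • fderiv ℝ K x).det := by
      intro x
      apply abs_of_pos
      apply det_one_add_smul_pos ht
      exact lt_of_le_of_lt (mul_le_mul_of_nonneg_left (norm_fderiv_le_of_lipschitz ℝ hK) ht) htL
    have h1 := integrableOn_image_iff_integrableOn_abs_det_fderiv_smul μ measurableSet_ball hder
      hbij.1.injOn (fun _ => (1 : ℝ))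
    have h2 := integral_image_eq_integral_abs_det_fderiv_smul μ measurableSet_ball hder
      hbij.1.injOn (fun _ => (1 : ℝ))
    simp only [himg, hpos, smul_eq_mul, mul_one] at h1 h2
    refine ⟨h1.1 (integrableOn_const measure_ball_lt_top.ne), ?_⟩
    rw [← h2]
    simp
  -- The nodes lie in `[0, 1/(L+1))`, where `small` applies; the `+ 1` also covers `L = 0`.
  obtain ⟨s, hs, hcard⟩ : ∃ s : Finset ℝ, (∀ i ∈ s, 0 ≤ i ∧ i * L < 1) ∧
      Module.finrank ℝ E < s.card := by
    have hinf : (Ico (0 : ℝ) (1 / (L + 1))).Infinite := Ico_infinite (by positivity)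
    obtain ⟨s, hs, hc⟩ := hinf.exists_subset_card_eq (Module.finrank ℝ E + 1)
    refine ⟨s, fun i hi => ⟨(hs hi).1, ?_⟩, by omega⟩
    have h1 := (hs hi).2
    rw [lt_div_iff₀ (by positivity)] at h1
    have := (hs hi).1
    nlinarith
  have hone : ∑ i ∈ s, (Lagrange.basis s id i).eval t = 1 := by
    rw [← Polynomial.eval_finsetSum, Lagrange.sum_basis Function.injective_id.injOn
      (Finset.card_pos.1 (Nat.zero_lt_of_lt hcard)), Polynomial.eval_one]
  simp_rw [det_one_add_smul_eq_sum s hcard _ t]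
  rw [integral_finsetSum _ fun i hi => ((small i (hs i hi).1 (hs i hi).2).1.mul_const _)]
  rw [Finset.sum_congr rfl fun i hi => by
    rw [integral_mul_const, (small i (hs i hi).1 (hs i hi).2).2]]
  rw [← Finset.mul_sum, hone, mul_one]

end NoRetraction

/-! ### From no retraction to Brouwer's fixed point theorem -/

section Brouwer

open Metric Set MeasureTheory Filter Topology

variable {E : Type*} [NormedAddCommGroup E] [InnerProductSpace ℝ E] [FiniteDimensional ℝ E]

/-- A map into a sphere has singular derivatives. -/
theorem det_fderiv_eq_zero_of_norm_eq {R : E → E} {x : E} {r : ℝ} (hr : r ≠ 0)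
    (hR : DifferentiableAt ℝ R x) (h : ∀ᶠ y in 𝓝 x, ‖R y‖ = r) : (fderiv ℝ R x).det = 0 := by
  by_contra hdet
  have h1 := hR.hasFDerivAt.norm_sq
  have h2 : HasFDerivAt (fun y => ‖R y‖ ^ 2) (0 : E →L[ℝ] ℝ) x := by
    refine (hasFDerivAt_const (r ^ 2) x).congr_of_eventuallyEq ?_
    filter_upwards [h] with y hy
    rw [hy]
  have h3 := h1.unique h2
  -- The vector `R x` is orthogonal to the range of the derivative; if the derivative were onto, `R
  -- x` would be orthogonal to itself.
  obtain ⟨v, hv⟩ := (LinearMap.equivOfDetNeZero _ hdet).surjective (R x)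
  have h4 := congrArg (fun l : E →L[ℝ] ℝ => l v) h3
  have hv' : fderiv ℝ R x v = R x := hv
  simp [hv', h.self_of_nhds] at h4
  exact hr h4

/-- There is no continuously differentiable retraction of a ball onto its boundary sphere. -/
theorem not_exists_contDiff_retraction {r : ℝ} (hr : 0 < r) {R : E → E} (hR : ContDiff ℝ 1 R)
    (hn : ∀ x, ‖R x‖ = r) (hid : ∀ x, ‖x‖ = r → R x = x) : False := by
  borelize E
  let k : E → E := fun x => R x - x
  have hk : ContDiff ℝ 1 k := hR.sub contDiff_id
  obtain ⟨L, hL⟩ := hk.contDiffOn.exists_lipschitzOnWith one_ne_zero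
    (convex_closedBall (0 : E) r) (isCompact_closedBall 0 r)
  have hsph : ∀ x, ‖x‖ = r → k x = 0 := fun x hx => by simp [k, hid x hx]
  let K : E → E := (ball 0 r).indicator k
  have hKin : ∀ x, ‖x‖ ≤ r → K x = k x := by
    intro x hx
    rcases hx.lt_or_eq with h | h
    · exact indicator_of_mem (mem_ball_zero_iff.2 h) _
    · rw [hsph x h]
      exact indicator_of_notMem (by simp [h]) _
  have hKout : ∀ x, r ≤ ‖x‖ → K x = 0 := fun x hx => indicator_of_notMem (by simpa using hx) _
  -- The segment from inside to outside crosses the sphere, where `k` vanishes, so the Lipschitz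
  -- bound on the inner part suffices.
  have hmix : ∀ x y, ‖x‖ ≤ r → r ≤ ‖y‖ → dist (K x) (K y) ≤ L * dist x y := by
    intro x y hx hy
    have hc : Continuous fun s : ℝ => ‖AffineMap.lineMap x y s‖ := by
      have : Continuous (AffineMap.lineMap x y : ℝ → E) := AffineMap.lineMap_continuous
      exact this.norm
    obtain ⟨s, hs, hsr⟩ := intermediate_value_Icc (zero_le_one' ℝ) hc.continuousOn
      (show r ∈ Icc _ _ by simpa using ⟨hx, hy⟩)
    have hsr : ‖AffineMap.lineMap x y s‖ = r := hsr
    have h1 := hL.dist_le_mul x (by simpa using hx) (AffineMap.lineMap x y s)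
      (by simpa using hsr.le)
    have h2 : k (AffineMap.lineMap x y s) = K y := by rw [hsph _ hsr, hKout y hy]
    rw [hKin x hx, ← h2]
    refine le_trans h1 (mul_le_mul_of_nonneg_left ?_ L.2)
    rw [dist_left_lineMap, Real.norm_of_nonneg hs.1]
    exact mul_le_of_le_one_left dist_nonneg hs.2
  have hK : LipschitzWith L K := by
    refine LipschitzWith.of_dist_le_mul fun x y => ?_
    rcases le_total ‖x‖ r with hx | hx <;> rcases le_total ‖y‖ r with hy | hy
    · rw [hKin x hx, hKin y hy]
      exact hL.dist_le_mul x (by simpa using hx) y (by simpa using hy)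
    · exact hmix x y hx hy
    · rw [dist_comm, dist_comm x]
      exact hmix y x hy hx
    · rw [hKout x hx, hKout y hy, dist_self]
      positivity
  have heq : ∀ x ∈ ball (0 : E) r, K =ᶠ[𝓝 x] k := fun x hx => by
    filter_upwards [isOpen_ball.mem_nhds hx] with y hy
    exact indicator_of_mem hy _
  have hRd : Differentiable ℝ R := hR.differentiable one_ne_zero
  have hd : DifferentiableOn ℝ K (ball 0 r) := fun x hx =>
    ((hRd.sub differentiable_id x).congr_of_eventuallyEq (heq x hx)).differentiableWithinAt
  have h1 := integral_det_one_add_smul_fderiv volume hK hKout hd 1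
  -- At `t = 1` the map `id + K` is `R`, whose derivative is singular: the integral is `0` and also
  -- the volume of the ball.
  have h2 : ∀ x ∈ ball (0 : E) r, (1 + (1 : ℝ) • fderiv ℝ K x).det = 0 := by
    intro x hx
    have : 1 + (1 : ℝ) • fderiv ℝ K x = fderiv ℝ R x := by
      rw [(heq x hx).fderiv_eq, fderiv_fun_sub (hRd x) differentiableAt_fun_id,
        fderiv_fun_id, one_smul]
      exact add_sub_cancel _ _
    rw [this]
    exact det_fderiv_eq_zero_of_norm_eq hr.ne' (hRd x) (.of_forall hn)
  rw [setIntegral_congr_fun measurableSet_ball h2, integral_zero] at h1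
  have h3 : 0 < volume.real (ball (0 : E) r) :=
    ENNReal.toReal_pos (measure_ball_pos _ _ hr).ne' measure_ball_lt_top.ne
  linarith

/-- A continuous self-map that is the identity outside of a ball has a zero. -/
theorem exists_eq_zero_of_eq_id_outside {r : ℝ} (hr : 0 < r) {H : E → E} (hH : Continuous H)
    (hid : ∀ x, r ≤ ‖x‖ → H x = x) : ∃ x, H x = 0 := by
  by_contra! hne
  obtain ⟨δ, hδ, hδH⟩ : ∃ δ > 0, ∀ x, δ ≤ ‖H x‖ := by
    obtain ⟨x₀, -, h₀⟩ := (isCompact_closedBall (0 : E) r).exists_isMinOn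
      ⟨0, by simp [hr.le]⟩ hH.norm.continuousOn
    refine ⟨min r ‖H x₀‖, lt_min hr (norm_pos_iff.2 (hne _)), fun x => ?_⟩
    rcases le_total ‖x‖ r with h | h
    · exact (min_le_right _ _).trans (h₀ (by simpa using h))
    · rw [hid x h]
      exact (min_le_left _ _).trans h
  have hk : Continuous fun x => H x - x := hH.sub continuous_id
  have hk0 : ∀ x, r ≤ ‖x‖ → H x - x = 0 := fun x hx => by rw [hid x hx, sub_self]
  have hsupp : HasCompactSupport fun x => H x - x :=
    HasCompactSupport.intro (isCompact_closedBall (0 : E) r) fun x hx =>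
      hk0 x (by simpa using (not_le.1 (by simpa using hx)).le)
  obtain ⟨ε, hε, hεk⟩ := Metric.uniformContinuous_iff.1
    (hsupp.uniformContinuous_of_continuous hk) (δ / 2) (half_pos hδ)
  -- Smoothing at scale below `ε` costs at most `δ / 2`, so `x + g x` has no zero; scale below `1`
  -- keeps `g` zero beyond radius `r + 1`. Normalizing `x + g x` then yields a forbidden retraction.
  obtain ⟨g, hg, hgk⟩ := hk.exists_contDiff_dist_le_of_forall_mem_ball_dist_le
    (lt_min hε one_pos)
  have hclose : ∀ x, ‖g x - (H x - x)‖ ≤ δ / 2 := fun x => by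
    rw [← dist_eq_norm]
    exact hgk x _ fun y hy => (hεk ((mem_ball.1 hy).trans_le (min_le_left _ _))).le
  have hg0 : ∀ x, r + 1 ≤ ‖x‖ → g x = 0 := by
    intro x hx
    have h1 := hgk x 0 fun y hy => by
      have h2 : dist y x < 1 := (mem_ball.1 hy).trans_le (min_le_right _ _)
      have h3 : ‖x‖ ≤ ‖y‖ + dist y x := by
        rw [dist_comm, dist_eq_norm]
        linarith [norm_sub_norm_le x y]
      rw [hk0 x (by linarith), hk0 y (by linarith), dist_self]
    rw [hk0 x (by linarith)] at h1
    exact dist_le_zero.1 h1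
  have hne' : ∀ x, x + g x ≠ 0 := by
    intro x hx
    have h1 := hclose x
    have h2 := hδH x
    rw [show g x - (H x - x) = -H x by rw [eq_neg_of_add_eq_zero_right hx]; abel, norm_neg] at h1
    linarith
  have hs : ContDiff ℝ 1 fun x => x + g x := contDiff_id.add (hg.of_le (by norm_cast))
  refine not_exists_contDiff_retraction (r := r + 1) (by linarith)
    (R := fun x => ((r + 1) / ‖x + g x‖) • (x + g x)) ?_ ?_ ?_
  · exact (contDiff_const.div (hs.norm ℝ hne') fun x => norm_ne_zero_iff.2 (hne' x)).smul hs
  · intro x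
    rw [norm_smul, norm_div, norm_norm, div_mul_cancel₀ _ (norm_ne_zero_iff.2 (hne' x)),
      Real.norm_of_nonneg (by linarith)]
  · intro x hx
    have : r + 1 ≠ 0 := by linarith
    simp [hg0 x hx.ge, hx, this]

/-- A continuous map on the unit ball that moves no point by more than `1` has a zero; this is a
form of Brouwer's fixed point theorem. -/
theorem exists_eq_zero_of_norm_sub_le {H : E → E} (hH : ContinuousOn H (closedBall 0 1))
    (hd : ∀ x ∈ closedBall (0 : E) 1, ‖H x - x‖ ≤ 1) : ∃ x ∈ closedBall (0 : E) 1, H x = 0 := by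
  let π : E → E := fun x => (max 1 ‖x‖)⁻¹ • x
  have hpos : ∀ x : E, 0 < max 1 ‖x‖ := fun x => lt_max_of_lt_left one_pos
  have hπ : Continuous π := by
    have : Continuous fun x : E => (max 1 ‖x‖)⁻¹ :=
      (continuous_const.max continuous_norm).inv₀ fun x => (hpos x).ne'
    exact this.smul continuous_id
  have hπm : ∀ x, π x ∈ closedBall (0 : E) 1 := by
    intro x
    rw [mem_closedBall_zero_iff, norm_smul, norm_inv, Real.norm_of_nonneg (hpos x).le,
      inv_mul_le_iff₀ (hpos x), mul_one]
    exact le_max_right _ _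
  have hπid : ∀ x, ‖x‖ ≤ 1 → π x = x := fun x hx => by simp [π, hx]
  let s : E → ℝ := fun x => max 0 (min 1 (2 - ‖x‖))
  have hs : Continuous s := by fun_prop
  have hHπ : Continuous fun x => H (π x) := by
    rw [← continuousOn_univ]
    exact hH.comp hπ.continuousOn fun x _ => hπm x
  -- The displacement of `H` is extended radially by `π` and cut off by `s`, which is `1` on the
  -- unit ball and `0` beyond radius `2`. A zero satisfies `‖x‖ ≤ s x ≤ 1`, so it lies where nothing
  -- was changed.
  obtain ⟨x, hx⟩ := exists_eq_zero_of_eq_id_outside (r := 2) two_pos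
    (H := fun x => x + s x • (H (π x) - π x))
    (continuous_id.add (hs.smul (hHπ.sub hπ))) (fun x hx => by
      have : s x = 0 := by
        apply max_eq_left
        exact (min_le_right _ _).trans (by linarith)
      simp [this])
  have h1 : ‖x‖ ≤ 1 := by
    by_contra! h1
    have h2 : ‖x‖ ≤ s x * 1 := by
      conv_lhs => rw [eq_neg_of_add_eq_zero_left hx, norm_neg, norm_smul,
        Real.norm_of_nonneg (le_max_left _ _)]
      exact mul_le_mul_of_nonneg_left (hd _ (hπm x)) (le_max_left _ _)
    have h3 : s x ≤ 1 := max_le zero_le_one (min_le_left _ _)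
    linarith
  refine ⟨x, by simpa using h1, ?_⟩
  have h2 : s x = 1 := by
    have : min 1 (2 - ‖x‖) = 1 := min_eq_left (by linarith)
    simp [s, this]
  simpa [h2, hπid x h1] using hx

end Brouwer

/-! ### Invariance of domain -/

section InvarianceOfDomain

open Metric Set MeasureTheory Filter Topology

section

variable {E : Type*} [NormedAddCommGroup E] [InnerProductSpace ℝ E] [FiniteDimensional ℝ E]

/-- A continuous map can be approximated on a compact set by a smooth map without zeros on a given
sphere. -/
theorem exists_continuous_approx_ne_zero_on_sphere {G : E → E} (hG : Continuous G) {K : Set E}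
    (hK : IsCompact K) {δ : ℝ} (hδ : 0 < δ) (c : E) {ε : ℝ} (hε : 0 < ε) :
    ∃ P : E → E, Continuous P ∧ (∀ x ∈ K, ‖P x - G x‖ < δ) ∧ ∀ x ∈ sphere c ε, P x ≠ 0 := by
  borelize E
  have hU : UniformContinuousOn G (cthickening 1 K) :=
    hK.cthickening.uniformContinuousOn_of_continuous hG.continuousOn
  obtain ⟨η, hη, hηG⟩ := Metric.uniformContinuousOn_iff.1 hU (δ / 2) (half_pos hδ)
  obtain ⟨P, hP, hPG⟩ := hG.exists_contDiff_dist_le_of_forall_mem_ball_dist_le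
    (lt_min one_pos hη)
  have hclose : ∀ x ∈ K, dist (P x) (G x) ≤ δ / 2 := by
    intro x hx
    refine hPG x _ fun y hy => ?_
    rw [mem_ball, lt_min_iff] at hy
    exact (hηG _ (mem_cthickening_of_dist_le _ x _ _ hx hy.1.le) _
      (self_subset_cthickening _ hx) hy.2).le
  -- A smooth map sends the null set `sphere c ε` to a null set, so an arbitrarily small translation
  -- moves `0` off the image.
  have hnull : volume (P '' sphere c ε) = 0 :=
    addHaar_image_eq_zero_of_differentiableOn_of_addHaar_eq_zero volume
      (hP.differentiable (by simp)).differentiableOn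
      (Measure.addHaar_sphere_of_ne_zero volume c hε.ne')
  obtain ⟨a, ha, haP⟩ : ∃ a ∈ ball (0 : E) (δ / 2), a ∉ P '' sphere c ε := by
    by_contra! h
    exact (measure_ball_pos volume (0 : E) (half_pos hδ)).ne'
      (measure_mono_null (fun a ha => h a ha) hnull)
  refine ⟨fun x => P x - a, hP.continuous.sub continuous_const, fun x hx => ?_, fun x hx h => ?_⟩
  · have h1 := hclose x hx
    rw [dist_eq_norm] at h1
    rw [mem_ball_zero_iff] at ha
    calc ‖P x - a - G x‖ = ‖(P x - G x) - a‖ := by congr 1; abel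
      _ ≤ ‖P x - G x‖ + ‖a‖ := norm_sub_le _ _
      _ < δ := by linarith
  · exact haP ⟨x, hx, sub_eq_zero.1 h⟩

/-- The image of the unit ball under a continuous injective map is a neighbourhood of the image of
the centre. -/
theorem image_closedBall_mem_nhds {f : E → E} (hf : ContinuousOn f (closedBall 0 1))
    (hinj : InjOn f (closedBall 0 1)) : f '' closedBall 0 1 ∈ 𝓝 (f 0) := by
  have h0 : (0 : E) ∈ closedBall (0 : E) 1 := by simp
  have hKc : IsCompact (f '' closedBall 0 1) := (isCompact_closedBall 0 1).image_of_continuousOn hf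
  obtain ⟨G, hG⟩ : ∃ G : C(E, E), ∀ x ∈ closedBall (0 : E) 1, G (f x) = x := by
    have : CompactSpace (closedBall (0 : E) 1) :=
      isCompact_iff_compactSpace.1 (isCompact_closedBall 0 1)
    have : TietzeExtension E := TietzeExtension.of_tvs ℝ
    have he : IsClosedEmbedding ((closedBall (0 : E) 1).domRestrict f) :=
      (continuousOn_iff_continuous_domRestrict.1 hf).isClosedEmbedding (injOn_iff_injective.1 hinj)
    obtain ⟨G, hG⟩ := ContinuousMap.exists_extension' he ⟨Subtype.val, continuous_subtype_val⟩
    exact ⟨G, fun x hx => congrFun hG ⟨x, hx⟩⟩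
  by_contra hnot
  obtain ⟨η, hη, hηG⟩ := Metric.continuous_iff.1 G.continuous (f 0) (1 / 10) (by norm_num)
  have hG0 : G (f 0) = 0 := hG 0 h0
  set ε := η / 2 with hεdef
  have hε : 0 < ε := half_pos hη
  obtain ⟨c, hc, hcK⟩ : ∃ c ∈ ball (f 0) ε, c ∉ f '' closedBall 0 1 := by
    by_contra! h
    exact hnot (mem_of_superset (ball_mem_nhds _ hε) h)
  have hnear : ∀ y, dist y c ≤ ε → ‖G y‖ < 1 / 10 := by
    intro y hy
    have h1 : dist y (f 0) < η := by
      have := dist_triangle y c (f 0)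
      rw [mem_ball] at hc
      linarith
    have := hηG y h1
    rwa [hG0, dist_zero_right] at this
  have hK1 : IsCompact (f '' closedBall 0 1 \ ball c ε) := hKc.diff isOpen_ball
  have hG1 : ∀ y ∈ f '' closedBall 0 1 \ ball c ε, G y ≠ 0 := by
    rintro _ ⟨⟨x, hx, rfl⟩, hy⟩ hGy
    rw [hG x hx] at hGy
    subst hGy
    rw [mem_ball, dist_comm] at hc
    exact hy hc
  obtain ⟨δ, hδ, hδ1, hδG⟩ : ∃ δ > 0, δ ≤ 1 / 10 ∧
      ∀ y ∈ f '' closedBall 0 1 \ ball c ε, δ ≤ ‖G y‖ := by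
    rcases (f '' closedBall 0 1 \ ball c ε).eq_empty_or_nonempty with h | h
    · exact ⟨1 / 10, by norm_num, le_rfl, by simp [h]⟩
    · obtain ⟨y, hy, hmin⟩ := hK1.exists_isMinOn h G.continuous.norm.continuousOn
      exact ⟨min (1 / 10) ‖G y‖, lt_min (by norm_num) (norm_pos_iff.2 (hG1 y hy)),
        min_le_left _ _, fun z hz => (min_le_right _ _).trans (hmin hz)⟩
  obtain ⟨P, hP, hPG, hPne⟩ := exists_continuous_approx_ne_zero_on_sphere G.continuous
    (hKc.union (isCompact_closedBall c ε)) hδ c hε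
  -- `Φ` pushes the part of the image near the missed point `c` radially onto `sphere c ε`, where
  -- `P` has no zero. So `P ∘ Φ` approximates the inverse `G` of `f` without vanishing on the image,
  -- contrary to Brouwer.
  let Φ : E → E := fun y => c + max 1 (ε / ‖y - c‖) • (y - c)
  have hΦfar : ∀ y, ε ≤ ‖y - c‖ → Φ y = y := by
    intro y hy
    have : max 1 (ε / ‖y - c‖) = 1 := max_eq_left (div_le_one_of_le₀ hy (norm_nonneg _))
    simp [Φ, this]
  have hne : ∀ y ∈ f '' closedBall 0 1, ‖y - c‖ ≠ 0 := by
    intro y hy h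
    rw [norm_eq_zero, sub_eq_zero] at h
    exact hcK (h ▸ hy)
  have hΦnear : ∀ y ∈ f '' closedBall 0 1, ‖y - c‖ ≤ ε → Φ y ∈ sphere c ε := by
    intro y hy h
    have hpos := lt_of_le_of_ne (norm_nonneg _) (hne y hy).symm
    have : max 1 (ε / ‖y - c‖) = ε / ‖y - c‖ := max_eq_right ((one_le_div hpos).2 h)
    rw [mem_sphere, dist_eq_norm]
    simp only [Φ, this, add_sub_cancel_left]
    rw [norm_smul, Real.norm_of_nonneg (by positivity), div_mul_cancel₀ _ hpos.ne']
  have hΦc : ContinuousOn Φ (f '' closedBall 0 1) := by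
    have h1 : ContinuousOn (fun y => max 1 (ε / ‖y - c‖)) (f '' closedBall 0 1) :=
      continuousOn_const.sup (continuousOn_const.div (by fun_prop) hne)
    exact continuousOn_const.add (h1.smul (by fun_prop))
  have hmaps : MapsTo f (closedBall 0 1) (f '' closedBall 0 1) := mapsTo_image _ _
  -- Far from `c`, the error is below `δ ≤ ‖G y‖`. Near `c`, the bound is a sum of three terms of
  -- size at most `1 / 10`.
  have key : ∀ y ∈ f '' closedBall 0 1, P (Φ y) ≠ 0 ∧ ‖P (Φ y) - G y‖ ≤ 1 := by
    intro y hy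
    rcases le_total ε ‖y - c‖ with h | h
    · have h1 := hPG y (.inl hy)
      have h2 := hδG y ⟨hy, by simpa [dist_eq_norm] using h⟩
      rw [hΦfar y h]
      refine ⟨fun h3 => ?_, by linarith⟩
      rw [h3, zero_sub, norm_neg] at h1
      linarith
    · have h1 := hΦnear y hy h
      refine ⟨hPne _ h1, ?_⟩
      have h2 := hPG (Φ y) (.inr (sphere_subset_closedBall h1))
      have h3 := hnear (Φ y) (mem_sphere.1 h1).le
      have h4 := hnear y (by rwa [dist_eq_norm])
      calc ‖P (Φ y) - G y‖ = ‖(P (Φ y) - G (Φ y)) + G (Φ y) - G y‖ := by congr 1; abel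
        _ ≤ ‖P (Φ y) - G (Φ y)‖ + ‖G (Φ y)‖ + ‖G y‖ :=
          (norm_sub_le _ _).trans (add_le_add_left (norm_add_le _ _) _)
        _ ≤ 1 := by linarith
  obtain ⟨x, hx, hx0⟩ := exists_eq_zero_of_norm_sub_le (H := fun x => P (Φ (f x)))
    (hP.comp_continuousOn (hΦc.comp hf hmaps))
    (fun x hx => by
      have := (key (f x) ⟨x, hx, rfl⟩).2
      rwa [hG x hx] at this)
  exact (key (f x) ⟨x, hx, rfl⟩).1 hx0

theorem isOpen_image_of_injOn_aux {f : E → E} {U : Set E} (hU : IsOpen U)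
    (hf : ContinuousOn f U) (hinj : InjOn f U) : IsOpen (f '' U) := by
  rw [isOpen_iff_mem_nhds]
  rintro _ ⟨x, hx, rfl⟩
  obtain ⟨r, hr, hrU⟩ := Metric.nhds_basis_closedBall.mem_iff.1 (hU.mem_nhds hx)
  let g : E → E := fun v => x + r • v
  have hg : MapsTo g (closedBall 0 1) U := by
    intro v hv
    apply hrU
    rw [mem_closedBall_zero_iff] at hv
    rw [mem_closedBall, dist_eq_norm, add_sub_cancel_left, norm_smul, Real.norm_of_nonneg hr.le]
    exact mul_le_of_le_one_right hr.le hv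
  have hginj : Function.Injective g := fun v w h => by
    simpa [g, hr.ne'] using h
  have hgc : Continuous g := by fun_prop
  have := image_closedBall_mem_nhds (f := f ∘ g) (hf.comp hgc.continuousOn hg)
    (hinj.comp hginj.injOn hg)
  have hgx : (f ∘ g) 0 = f x := by simp [g]
  rw [hgx] at this
  refine mem_of_superset this ?_
  rw [image_comp]
  exact image_mono hg.image_subset

end

/-- **Invariance of domain**: a continuous injective map from an open subset of a real vector space
to one of the same finite dimension is open. -/
theorem isOpen_image_of_injOn {E F : Type*} [NormedAddCommGroup E] [NormedSpace ℝ E]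
    [FiniteDimensional ℝ E] [NormedAddCommGroup F] [NormedSpace ℝ F] [FiniteDimensional ℝ F]
    (hEF : Module.finrank ℝ E = Module.finrank ℝ F) {f : E → F} {U : Set E} (hU : IsOpen U)
    (hf : ContinuousOn f U) (hinj : InjOn f U) : IsOpen (f '' U) := by
  let V := EuclideanSpace ℝ (Fin (Module.finrank ℝ E))
  let e : V ≃L[ℝ] E := ContinuousLinearEquiv.ofFinrankEq (by simp [V])
  let e' : F ≃L[ℝ] V := ContinuousLinearEquiv.ofFinrankEq (by simp [V, hEF])
  have hm : MapsTo e (e ⁻¹' U) U := mapsTo_preimage _ _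
  have h := isOpen_image_of_injOn_aux (f := e' ∘ f ∘ e) (U := e ⁻¹' U)
    (hU.preimage e.continuous)
    (e'.continuous.comp_continuousOn (hf.comp e.continuous.continuousOn hm))
    (e'.injective.comp_injOn (hinj.comp e.injective.injOn hm))
  rw [image_comp, image_comp, image_preimage_eq _ e.surjective] at h
  have := h.preimage e'.continuous
  rwa [preimage_image_eq _ e'.injective] at this

/-- Invariance of domain on the unit sphere. -/
theorem isOpen_image_of_injOn_sphere {E F : Type*} [NormedAddCommGroup E] [NormedSpace ℝ E]
    [FiniteDimensional ℝ E] [NormedAddCommGroup F] [NormedSpace ℝ F] [FiniteDimensional ℝ F]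
    (hEF : Module.finrank ℝ E = Module.finrank ℝ F + 1) {f : E → F} {O : Set E} (hO : IsOpen O)
    (hf : ContinuousOn f (sphere 0 1 ∩ O)) (hinj : InjOn f (sphere 0 1 ∩ O)) :
    IsOpen (f '' (sphere 0 1 ∩ O)) := by
  -- Coning off reduces to the open case: `y ↦ (‖y‖, f (ν y))` is injective on an open cone, and the
  -- slice of its image at height `1` is the image of `f`.
  let ν : E → E := fun y => ‖y‖⁻¹ • y
  have hν : ContinuousOn ν {0}ᶜ :=
    (continuous_norm.continuousOn.inv₀ fun y hy => norm_ne_zero_iff.2 hy).smul continuousOn_id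
  have hνs : ∀ y ∈ ({0}ᶜ : Set E), ν y ∈ sphere (0 : E) 1 := by
    intro y hy
    rw [mem_sphere_zero_iff_norm, norm_smul, norm_inv, norm_norm,
      inv_mul_cancel₀ (norm_ne_zero_iff.2 hy)]
  let W : Set E := {0}ᶜ ∩ ν ⁻¹' O
  have hW : IsOpen W := hν.isOpen_inter_preimage isOpen_compl_singleton hO
  have hm : MapsTo ν W (sphere 0 1 ∩ O) := fun y hy => ⟨hνs y hy.1, hy.2⟩
  have h1 := isOpen_image_of_injOn (F := ℝ × F) (f := fun y => (‖y‖, f (ν y))) (U := W)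
    (by simp [hEF, add_comm]) hW
    (continuous_norm.continuousOn.prodMk (hf.comp (hν.mono inter_subset_left) hm))
    (by
      intro y hy y' hy' h
      rw [Prod.mk.injEq] at h
      have h2 : ν y = ν y' := hinj (hm hy) (hm hy') h.2
      have h3 : ‖y'‖⁻¹ ≠ 0 := inv_ne_zero (norm_ne_zero_iff.2 hy'.1)
      simp only [ν, h.1] at h2
      exact smul_right_injective E h3 h2)
  have h2 : f '' (sphere 0 1 ∩ O) = (fun v => ((1 : ℝ), v)) ⁻¹'
      ((fun y => (‖y‖, f (ν y))) '' W) := by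
    ext v
    constructor
    · rintro ⟨y, ⟨hy, hyO⟩, rfl⟩
      rw [mem_sphere_zero_iff_norm] at hy
      have hy0 : y ≠ 0 := by
        rintro rfl
        simp at hy
      have hνy : ν y = y := by simp [ν, hy]
      exact ⟨y, ⟨hy0, by rwa [mem_preimage, hνy]⟩, by simp [hy, hνy]⟩
    · rintro ⟨y, hy, h⟩
      rw [Prod.mk.injEq] at h
      exact ⟨ν y, hm hy, h.2⟩
  rw [h2]
  exact h1.preimage (by fun_prop)

end InvarianceOfDomain

/-! ### The diamond property of regular CW complexes -/

section Diamond

open Topology Metric Set Topology.RelCWComplex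

variable {X : Type u} [TopologicalSpace X] {C : Set X} [CWComplex C]

/-- The inverse of the characteristic map of a cell of a regular complex, on the closed cell. -/
noncomputable def Cell.chart (e : Cell C) : X → (Fin e.dim → ℝ) :=
  Function.invFunOn (map e.dim e.idx) (closedBall 0 1)

/-- The open cell. -/
def Cell.interior (e : Cell C) : Set X := openCell e.dim e.idx

/-- The boundary of a cell. -/
def Cell.frontier (e : Cell C) : Set X := cellFrontier e.dim e.idx

theorem Cell.carrier_eq (e : Cell C) : e.carrier = e.frontier ∪ e.interior :=
  (cellFrontier_union_openCell_eq_closedCell _ _).symm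

theorem Cell.disjoint_interior {e e' : Cell C} (h : e ≠ e') : Disjoint e.interior e'.interior := by
  apply disjoint_openCell_of_ne
  intro h'
  apply h
  obtain ⟨n, i⟩ := e
  obtain ⟨m, j⟩ := e'
  cases h'
  rfl

theorem Cell.map_chart (e : Cell C) {p : X} (hp : p ∈ e.carrier) :
    map e.dim e.idx (e.chart p) = p := Function.invFunOn_eq hp

theorem Cell.chart_mem (e : Cell C) {p : X} (hp : p ∈ e.carrier) :
    e.chart p ∈ closedBall 0 1 := Function.invFunOn_mem hp

theorem Cell.injOn_chart (e : Cell C) : InjOn e.chart e.carrier := fun p hp q hq h => by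
  rw [← e.map_chart hp, h, e.map_chart hq]

theorem IsRegularCW.chart_map (hC : IsRegularCW C) (e : Cell C) {v : Fin e.dim → ℝ}
    (hv : v ∈ closedBall 0 1) : e.chart (map e.dim e.idx v) = v :=
  (hC e.dim e.idx).leftInvOn_invFunOn hv

theorem IsRegularCW.mem_interior_iff (hC : IsRegularCW C) (e : Cell C) {p : X}
    (hp : p ∈ e.carrier) : p ∈ e.interior ↔ e.chart p ∈ ball 0 1 := by
  constructor
  · rintro ⟨v, hv, rfl⟩
    rwa [hC.chart_map e (ball_subset_closedBall hv)]
  · intro h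
    exact ⟨_, h, e.map_chart hp⟩

/-- Invariance of domain for the boundary of a cell. -/
theorem IsRegularCW.isOpen_image (hC : IsRegularCW C) (z : Cell C) {F : Type*}
    [NormedAddCommGroup F] [NormedSpace ℝ F] [FiniteDimensional ℝ F]
    (hF : z.dim = Module.finrank ℝ F + 1) {f : X → F} {O : Set X}
    (hO : IsOpen O) (hf : ContinuousOn f (z.frontier ∩ O)) (hinj : InjOn f (z.frontier ∩ O)) :
    IsOpen (f '' (z.frontier ∩ O)) := by
  have hcont : ContinuousOn (map z.dim z.idx) (sphere 0 1) :=
    (RelCWComplex.continuousOn _ _).mono sphere_subset_closedBall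
  obtain ⟨O', hO', h⟩ := continuousOn_iff'.1 hcont O hO
  have himg : map z.dim z.idx '' (sphere 0 1 ∩ O') = z.frontier ∩ O := by
    rw [inter_comm, ← h, image_preimage_inter, inter_comm]
    rfl
  have hm : MapsTo (map z.dim z.idx) (sphere 0 1 ∩ O') (z.frontier ∩ O) :=
    himg ▸ mapsTo_image _ _
  rw [← himg, ← image_comp]
  exact isOpen_image_of_injOn_sphere (by simpa using hF) hO'
    (hf.comp (hcont.mono inter_subset_left) hm)
    (hinj.comp ((hC _ _).mono (inter_subset_left.trans sphere_subset_closedBall)) hm)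

theorem finite_cell [RelCWComplex.Finite C] : _root_.Finite (Cell C) := by
  have := finite_cells_of_finite (C := C)
  exact Finite.of_injective (fun e : Cell C => (⟨e.dim, e.idx⟩ : Σ n, cell C n)) (by
    rintro ⟨n, i⟩ ⟨m, j⟩ h
    cases h
    rfl)

variable [T2Space X]

theorem Cell.isClosed_carrier (e : Cell C) : IsClosed e.carrier := isClosed_closedCell

theorem Cell.frontier_subset (e : Cell C) :
    e.frontier ⊆ ⋃ e' ∈ {e' : Cell C | e'.dim < e.dim}, e'.carrier := by
  intro p hp
  obtain ⟨m, hm, j, hj⟩ := CWComplex.mem_skeletonLT_iff.1 (cellFrontier_subset_skeletonLT _ _ hp)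
  exact mem_biUnion (x := (⟨m, j⟩ : Cell C)) (by simpa using hm)
    (openCell_subset_closedCell m j hj)

theorem Cell.disjoint_interior_frontier {e e' : Cell C} (h : e'.dim ≤ e.dim) :
    Disjoint e.interior e'.frontier := by
  refine Disjoint.symm (Disjoint.mono_left ?_ (disjoint_skeletonLT_openCell (n := (e.dim : ℕ∞))
    le_rfl))
  exact (cellFrontier_subset_skeletonLT _ _).trans (skeletonLT_mono (Nat.cast_le.2 h))

theorem Cell.disjoint_interior_carrier {e e' : Cell C} (h : e'.dim ≤ e.dim) (hne : e' ≠ e) :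
    Disjoint e.interior e'.carrier := by
  rw [e'.carrier_eq, disjoint_union_right]
  exact ⟨Cell.disjoint_interior_frontier h, Cell.disjoint_interior hne.symm⟩

theorem Cell.interior_subset_frontier {e e' : Cell C} (h : e < e') : e.interior ⊆ e'.frontier := by
  intro p hp
  have hpe : p ∈ e'.carrier := h.le (openCell_subset_closedCell _ _ hp)
  rw [e'.carrier_eq] at hpe
  exact hpe.resolve_right fun h' => disjoint_left.1 (Cell.disjoint_interior h.ne) hp h'

theorem Cell.le_of_interior_subset {e e' : Cell C} (h : e.interior ⊆ e'.carrier) : e ≤ e' := by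
  show closedCell _ _ ⊆ _
  rw [← closure_openCell_eq_closedCell]
  exact closure_minimal h e'.isClosed_carrier

variable (hC : IsRegularCW C)

include hC

/-- The characteristic map sends closed subsets of the compact ball to closed sets, so its inverse
is continuous. -/
theorem IsRegularCW.continuousOn_chart (e : Cell C) : ContinuousOn e.chart e.carrier := by
  have : CompactSpace (closedBall (0 : Fin e.dim → ℝ) 1) :=
    isCompact_iff_compactSpace.1 (isCompact_closedBall 0 1)
  rw [continuousOn_iff_isClosed]
  intro t ht
  refine ⟨map e.dim e.idx '' (closedBall 0 1 ∩ t), ?_, ?_⟩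
  · exact (((isCompact_closedBall 0 1).inter_right ht).image_of_continuousOn
      ((RelCWComplex.continuousOn _ _).mono inter_subset_left)).isClosed
  · ext p
    constructor
    · rintro ⟨hp, hpe⟩
      exact ⟨⟨e.chart p, ⟨e.chart_mem hpe, hp⟩, e.map_chart hpe⟩, hpe⟩
    · rintro ⟨⟨v, ⟨hv, hvt⟩, rfl⟩, hpe⟩
      exact ⟨by rwa [mem_preimage, hC.chart_map e hv], hpe⟩

/-- An open part of the boundary of a cell is not contained in a closed cell of dimension at least
two lower. -/
theorem IsRegularCW.eq_empty_of_subset_carrier (z e : Cell C) (hd : e.dim + 1 < z.dim) {O : Set X}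
    (hO : IsOpen O) (h : z.frontier ∩ O ⊆ e.carrier) : z.frontier ∩ O = ∅ := by
  by_contra hne
  obtain ⟨p, hp⟩ := nonempty_iff_ne_empty.2 hne
  obtain ⟨d, hd⟩ : ∃ d, z.dim = e.dim + (d + 1) + 1 := ⟨z.dim - e.dim - 2, by omega⟩
  -- The chart of `e` is padded by `d + 1 ≥ 1` zero coordinates to reach dimension `z.dim - 1`. Its
  -- image would be open, yet it meets a line transverse to the slice in one point.
  have h1 := hC.isOpen_image z (F := (Fin e.dim → ℝ) × (Fin (d + 1) → ℝ))
    (f := fun p => (e.chart p, 0)) (by simpa using hd) hO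
    (((hC.continuousOn_chart e).mono h).prodMk continuousOn_const)
    (fun p hp q hq hpq => e.injOn_chart (h hp) (h hq) (Prod.mk.inj hpq).1)
  have h2 : Continuous fun t : ℝ => (e.chart p, fun _ : Fin (d + 1) => t) := by fun_prop
  have h3 := h1.preimage h2
  have h4 : (fun t : ℝ => (e.chart p, fun _ : Fin (d + 1) => t)) ⁻¹'
      ((fun p => (e.chart p, (0 : Fin (d + 1) → ℝ))) '' (z.frontier ∩ O)) = {0} := by
    ext t
    constructor
    · rintro ⟨q, -, hq⟩
      exact (congrFun (Prod.mk.inj hq).2 0).symm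
    · rintro rfl
      exact ⟨p, hp, rfl⟩
  rw [h4] at h3
  exact not_isOpen_singleton (0 : ℝ) h3

/-- An open part of the boundary of a cell is not contained in a finite union of closed cells of
dimension at least two lower. -/
theorem IsRegularCW.eq_empty_of_subset_biUnion (z : Cell C) {T : Set (Cell C)} (hT : T.Finite)
    (hd : ∀ e ∈ T, e.dim + 1 < z.dim) {O : Set X} (hO : IsOpen O)
    (h : z.frontier ∩ O ⊆ ⋃ e ∈ T, e.carrier) : z.frontier ∩ O = ∅ := by
  induction T, hT using Set.Finite.induction_on generalizing O with
  | empty => simpa using h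
  | @insert e T _ _ ih =>
    have h1 : z.frontier ∩ (O \ e.carrier) = ∅ := by
      refine ih (fun e he => hd e (mem_insert_of_mem _ he)) (hO.sdiff e.isClosed_carrier) ?_
      rintro p ⟨hp, hpO, hpe⟩
      have := h ⟨hp, hpO⟩
      rw [biUnion_insert] at this
      exact this.resolve_left hpe
    refine hC.eq_empty_of_subset_carrier z e (hd e (mem_insert _ _)) hO ?_
    rintro p ⟨hp, hpO⟩
    by_contra hpe
    exact (h1 ▸ (⟨hp, hpO, hpe⟩ : p ∈ z.frontier ∩ (O \ e.carrier)) : p ∈ (∅ : Set X))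

variable [RelCWComplex.Finite C]

/-- In a finite regular complex, a cell that meets the boundary of a cell of one dimension higher
is contained in it. -/
theorem IsRegularCW.le_of_inter_nonempty {e z : Cell C} (hd : z.dim = e.dim + 1)
    (h : (e.interior ∩ z.frontier).Nonempty) : e ≤ z := by
  have := finite_cell (C := C)
  let T : Set (Cell C) := {e' | e'.dim ≤ e.dim ∧ e' ≠ e}
  -- Removing all other closed cells of dimension at most `e.dim` leaves only the open cell `e` of
  -- the boundary of `z`.
  let O : Set X := (⋃ e' ∈ T, e'.carrier)ᶜ
  have hO : IsOpen O :=
    ((Set.toFinite T).isClosed_biUnion fun e' _ => e'.isClosed_carrier).isOpen_compl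
  have hOe : z.frontier ∩ O = z.frontier ∩ e.interior := by
    ext p
    refine and_congr_right fun hp => ⟨fun hpO => ?_, fun hpe hpT => ?_⟩
    · obtain ⟨e', he', hpe'⟩ := mem_iUnion₂.1 (z.frontier_subset hp)
      have he' : e'.dim < z.dim := he'
      have key : ∀ e' : Cell C, e'.dim ≤ e.dim → p ∈ e'.carrier → e' = e := by
        intro e' h1 h2
        by_contra h3
        exact hpO (mem_biUnion (show e' ∈ T from ⟨h1, h3⟩) h2)
      obtain rfl := key e' (by omega) hpe'
      rw [e'.carrier_eq] at hpe'
      refine hpe'.resolve_left fun hf => ?_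
      obtain ⟨e'', h1, h2⟩ := mem_iUnion₂.1 (e'.frontier_subset hf)
      have h1 : e''.dim < e'.dim := h1
      have := key e'' h1.le h2
      rw [this] at h1
      exact lt_irrefl _ h1
    · obtain ⟨e', he', hpe'⟩ := mem_iUnion₂.1 hpT
      exact disjoint_left.1 (Cell.disjoint_interior_carrier he'.1 he'.2) hpe hpe'
  have hsub : z.frontier ∩ O ⊆ e.carrier := by
    rw [hOe, e.carrier_eq]
    exact inter_subset_right.trans subset_union_right
  have hopen := hC.isOpen_image z (f := e.chart) (by simpa using hd) hO
    ((hC.continuousOn_chart e).mono hsub) (e.injOn_chart.mono hsub)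
  have hcl : IsClosed (closedBall 0 1 ∩ map e.dim e.idx ⁻¹' z.frontier) :=
    (RelCWComplex.continuousOn _ _).preimage_isClosed_of_isClosed isClosed_closedBall
      isClosed_cellFrontier
  have himg : e.chart '' (z.frontier ∩ O) = ball 0 1 ∩ map e.dim e.idx ⁻¹' z.frontier := by
    rw [hOe]
    ext v
    constructor
    · rintro ⟨p, ⟨hp, hpe⟩, rfl⟩
      have hpc : p ∈ e.carrier := openCell_subset_closedCell _ _ hpe
      exact ⟨(hC.mem_interior_iff e hpc).1 hpe, by rwa [mem_preimage, e.map_chart hpc]⟩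
    · rintro ⟨hv, hvz⟩
      exact ⟨_, ⟨hvz, ⟨v, hv, rfl⟩⟩, hC.chart_map e (ball_subset_closedBall hv)⟩
  -- The part of the open cell lying in the boundary of `z` is open by invariance of domain,
  -- relatively closed and nonempty; the ball is connected.
  have hball : ball (0 : Fin e.dim → ℝ) 1 ⊆ e.chart '' (z.frontier ∩ O) := by
    refine (convex_ball (0 : Fin e.dim → ℝ) 1).isPreconnected.subset_of_closure_inter_subset hopen
      ?_ ?_
    · obtain ⟨p, hpe, hpz⟩ := h
      refine ⟨e.chart p, ?_, p, ?_, rfl⟩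
      · exact (hC.mem_interior_iff e (openCell_subset_closedCell _ _ hpe)).1 hpe
      · rw [hOe]
        exact ⟨hpz, hpe⟩
    · rw [himg]
      rintro v ⟨hv, hvb⟩
      exact ⟨hvb, (closure_minimal (inter_subset_inter_left _ ball_subset_closedBall) hcl hv).2⟩
  apply Cell.le_of_interior_subset
  rintro _ ⟨v, hv, rfl⟩
  have hv' := hball hv
  rw [himg] at hv'
  rw [z.carrier_eq]
  exact .inl hv'.2

/-- The diamond property: if `x < y < z` are cells of consecutive dimensions in a finite regular
complex, then there is another cell between `x` and `z`. -/
theorem IsRegularCW.exists_ne_between {x y z : Cell C} (hxy : x < y) (hyz : y < z)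
    (hy : y.dim = x.dim + 1) (hz : z.dim = y.dim + 1) :
    ∃ y' : Cell C, y' ≠ y ∧ y'.dim = y.dim ∧ x ≤ y' ∧ y' ≤ z := by
  have := finite_cell (C := C)
  by_contra! hno
  obtain ⟨p, hp⟩ : x.interior.Nonempty := openCell_nonempty _ _
  have hpz : p ∈ z.frontier := Cell.interior_subset_frontier (hxy.trans hyz) hp
  -- Every closed cell that meets `O` contains `p`.
  let T : Set (Cell C) := {e | p ∉ e.carrier}
  let O : Set X := (⋃ e ∈ T, e.carrier)ᶜ
  have hO : IsOpen O :=
    ((Set.toFinite T).isClosed_biUnion fun e _ => e.isClosed_carrier).isOpen_compl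
  have hpO : p ∈ O := by
    intro h
    obtain ⟨e, he, hpe⟩ := mem_iUnion₂.1 h
    exact he hpe
  -- A cell `e ≠ y` of codimension one in `z` that reaches `O` contains `p`, hence `x ≤ e`. Its
  -- interior cannot meet the boundary of `z`, since then `e ≤ z`; only cells of lower dimension are
  -- left outside `y`.
  have hlow : z.frontier ∩ (O \ y.carrier) ⊆ ⋃ e ∈ {e : Cell C | e.dim + 1 < z.dim}, e.carrier := by
    rintro q ⟨hq, hqO, hqy⟩
    obtain ⟨e, he, hqe⟩ := mem_iUnion₂.1 (z.frontier_subset hq)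
    have he : e.dim < z.dim := he
    by_cases hd : e.dim + 1 < z.dim
    · exact mem_biUnion (show e ∈ {e : Cell C | e.dim + 1 < z.dim} from hd) hqe
    have hey : e ≠ y := by
      rintro rfl
      exact hqy hqe
    have hpe : p ∈ e.carrier := by
      by_contra hpe
      exact hqO (mem_biUnion (show e ∈ T from hpe) hqe)
    have hpf : p ∈ e.frontier := by
      rw [e.carrier_eq] at hpe
      refine hpe.resolve_right fun h => ?_
      refine disjoint_left.1 (Cell.disjoint_interior ?_) hp h
      rintro rfl
      omega
    have hxe : x ≤ e := hC.le_of_inter_nonempty (by omega) ⟨p, hp, hpf⟩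
    rw [e.carrier_eq] at hqe
    rcases hqe with hqe | hqe
    · obtain ⟨e', he', hqe'⟩ := mem_iUnion₂.1 (e.frontier_subset hqe)
      have he' : e'.dim < e.dim := he'
      exact mem_biUnion (show e' ∈ {e : Cell C | e.dim + 1 < z.dim} by
        show e'.dim + 1 < z.dim
        omega) hqe'
    · exact absurd (hC.le_of_inter_nonempty (by omega) ⟨q, hqe, hq⟩) (hno e hey (by omega) hxe)
  have hempty := hC.eq_empty_of_subset_biUnion z (Set.toFinite _) (fun e he => he)
    (hO.sdiff y.isClosed_carrier) hlow
  have hsub : z.frontier ∩ O ⊆ y.carrier := by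
    rintro q ⟨hq, hqO⟩
    by_contra hqy
    exact (hempty ▸ (⟨hq, hqO, hqy⟩ : q ∈ z.frontier ∩ (O \ y.carrier)) : q ∈ (∅ : Set X))
  have hopen := hC.isOpen_image z (f := y.chart) (by simpa using hz) hO
    ((hC.continuousOn_chart y).mono hsub) (y.injOn_chart.mono hsub)
  -- An open set inside the closed ball lies in the open ball. So `p` would be interior to `y`,
  -- although it belongs to the open cell `x`.
  have hball : y.chart '' (z.frontier ∩ O) ⊆ ball 0 1 := by
    rw [← interior_closedBall (0 : Fin y.dim → ℝ) one_ne_zero]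
    refine interior_maximal ?_ hopen
    rintro _ ⟨q, hq, rfl⟩
    exact y.chart_mem (hsub hq)
  have hpy : p ∈ y.interior := (hC.mem_interior_iff y (hsub ⟨hpz, hpO⟩)).2
    (hball ⟨p, ⟨hpz, hpO⟩, rfl⟩)
  exact disjoint_left.1 (Cell.disjoint_interior hxy.ne) hp hpy

/-- No cell of a finite regular complex is both the upper and the lower cell of a regular pair. -/
theorem IsDiscreteMorse.not_isRegularPair {f : Cell C → ℝ} (hf : IsDiscreteMorse f) {x y z : Cell C}
    (hxy : IsRegularPair f x y) : ¬ IsRegularPair f y z := by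
  intro hyz
  obtain ⟨y', hne, hd, hx, hz⟩ := hC.exists_ne_between hxy.lt hyz.lt hxy.1 hyz.1
  -- The partner of `x` above and the partner of `z` below are both `y`, so `y'` obeys the strict
  -- inequalities `f x < f y' < f z`.
  have h1 : f x < f y' := by
    by_contra h
    exact hne ((hf x).1 ⟨hd.trans hxy.1, hx, not_lt.1 h⟩ hxy)
  have h2 : f y' < f z := by
    by_contra h
    exact hne ((hf z).2 ⟨by rw [hd]; exact hyz.1.symm, hz, not_lt.1 h⟩
      ⟨hyz.1.symm, hyz.2.1, hyz.2.2⟩)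
  have h3 := hxy.2.2
  have h4 := hyz.2.2
  linarith

end Diamond

end DiscreteFlow

theorem mainTheorem7 {X : Type u} [TopologicalSpace X] [T2Space X] (C : Set X)
    [Topology.CWComplex C] [Topology.RelCWComplex.Finite C]
    (hC : DiscreteFlow.IsRegularCW C)
    (f : DiscreteFlow.Cell C → ℝ) (hf : DiscreteFlow.IsDiscreteMorse f)
    (w z : DiscreteFlow.Flo f) :
    (∀ γ : w ⟶ z, ∃! s : List (DiscreteFlow.Cell C),
      DiscreteFlow.IsSimplePath (DiscreteFlow.flowGraph f) w.cell z.cell s ∧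
        DiscreteFlow.Represents s γ) ∧
    (∀ s : List (DiscreteFlow.Cell C),
      DiscreteFlow.IsSimplePath (DiscreteFlow.flowGraph f) w.cell z.cell s →
        ∃! γ : w ⟶ z, DiscreteFlow.Represents s γ) :=
  DiscreteFlow.existsUnique_simplePath
    (hf.isMorseMatching fun _ _ _ h => hf.not_isRegularPair hC h) w z
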